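/- Let $b$ and $c$ be integers, $f(n)=n^2+2bn+c$, and suppose that $\delta:=b^2-c$ is non-zero and square-free and that $\delta\not\equiv 1\pmod 4$. Assume also that $f(n)\ge 0$ for every integer $n\ge 1$. Let $\chi(n)=\left(\frac{4\delta}{n}\right)$ be the Kronecker symbol, $L(1,\chi)=\sum_{n=1}^{\infty}\chi(n)/n$ (a convergent series), let $\tau(m)$ be the number of positive divisors of $m$, let $\zeta$ be the Riemann zeta function, and put $$M_\delta=\begin{cases}\dfrac{4}{\pi^2}\,\delta^{1/2}\log(4\delta)+1.8934\,\delta^{1/2}+1.668, & \delta>0,\\[2mm] \dfrac{1}{\pi}\,|\delta|^{1/2}\log(4|\delta|)+1.6408\,|\delta|^{1/2}+1.0285, & \delta<0.\end{cases}$$ Then for every integer $N\ge 1$ with $f(N)\ge f(1)$, writing $X:=\sqrt{f(N)}$, we have $$\sum_{n=1}^N\tau(n^2+2bn+c)\le \frac{2}{\zeta(2)}L(1,\chi)\,N\log X+\left(2.332\,L(1,\chi)+\frac{4M_\delta}{\zeta(2)}\right)N+\frac{2M_\delta}{\zeta(2)}X+4\sqrt3\left(1-\frac1{\zeta(2)}\right)M_\delta\frac{N}{\sqrt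 X}+2\sqrt3\left(1-\frac1{\zeta(2)}\right)M_\delta\sqrt X .$$ -/

import Mathlib

open Filter Topology

namespace QuadraticDivisorSum

/-- The number `τ(m)` of positive divisors of a non-zero integer `m`. -/
def tau (m : ℤ) : ℕ := m.natAbs.divisors.card

/-- The quadratic polynomial `f(n) = n² + 2bn + c`. -/
def quad (b c n : ℤ) : ℤ := n ^ 2 + 2 * b * n + c

/-- The discriminant `δ = b² - c`. -/
def disc (b c : ℤ) : ℤ := b ^ 2 - c

/-- The Kronecker symbol `(a / n)` for an integer `a` and a natural number `n`. For
`n = 2 ^ k * m` with `m` odd it is `(a / 2) ^ k` times the Jacobi symbol `(a / m)`, where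
`(a / 2)` is `0` for even `a`, `1` for `a ≡ ±1 (mod 8)` and `-1` for `a ≡ ±3 (mod 8)`,
which is Mathlib's character `ZMod.χ₈`. For `n = 0` it is `1` if `a = ±1`, else `0`. -/
def kroneckerSym (a : ℤ) (n : ℕ) : ℤ :=
  if n = 0 then (if a.natAbs = 1 then 1 else 0)
  else ZMod.χ₈ (a : ZMod 8) ^ n.factorization 2 * jacobiSym a (n / 2 ^ n.factorization 2)

/-- The real number `ζ(2)`. -/
noncomputable def zetaTwo : ℝ := (riemannZeta 2).re

/-- The explicit Pólya–Vinogradov constant `M_δ`, for a non-zero integer `δ`. -/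
noncomputable def polyaConst (δ : ℤ) : ℝ :=
  if 0 < δ then
    4 / Real.pi ^ 2 * √(δ : ℝ) * Real.log (4 * (δ : ℝ)) + 1.8934 * √(δ : ℝ) + 1.668
  else
    1 / Real.pi * √|(δ : ℝ)| * Real.log (4 * |(δ : ℝ)|) + 1.6408 * √|(δ : ℝ)| + 1.0285

end QuadraticDivisorSum

namespace QuadraticDivisorSum

/-! Divisors of m pair off across √m, and f(n) ≤ f(N) = X² for 1 ≤ n ≤ N, so τ(f(n)) is at most
twice the number of d ≤ X dividing f(n). As f(n) = (n + b)² - δ, the n with d ∣ f(n) fill residue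
classes indexed by the square roots of δ modulo d. With ρ(d) such roots, the divisor sum is at most
2 Σ_{d ≤ X} (N/d + 1) ρ(d) (`sum_tau_le`).

Since δ is squarefree and not 1 modulo 4, a check at prime powers gives ρ ≤ μ² * χ
(`rootCount_le_conv`). In the two resulting sums, over (μ² * χ)(d)/d and over (μ² * χ)(d), the
χ-variable is summed first. If all partial sums of χ are at most M in absolute value, then partial
summation bounds the sum of χ(m)/m over m ≤ y by L(1, χ) + 2M/(y + 1). What remains is Q, the number
of squarefree integers up to X, and R, the sum of their reciprocals (`sum_conv_le`,
`sum_conv_div_le`). The divisor sum is thus at most 2N(L R + 2MQ/X) + 2MQ. An upper bound for R may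
be inserted because L ≥ 0 (`limit_nonneg`).

Three explicit estimates finish the proof. `sqfreeCount_le` bounds Q: the squares 4 and 9 are sieved
exactly, Möbius inversion handles the d coprime to 6, and small arguments are computed.
`sqfreeRecip_le` deduces R by partial summation. `abs_sum_kroneckerSym_le` is Pólya–Vinogradov: χ is
primitive modulo 4|δ|, so its Gauss sum has modulus √(4|δ|). A sum of χ is compared with its average
over shifted windows, where the Fourier coefficients become products of two geometric sums. The
window length and the frequency cut-off are then optimised. -/

/-! ### Counting squarefree integers: Möbius inversion away from 6. -/

/-- The number of squarefree integers in `[1, n]`. -/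
def sqfreeCount (n : ℕ) : ℕ := ((Finset.Icc 1 n).filter Squarefree).card

/-- The Möbius function supported on integers coprime to `6`. -/
noncomputable def moebiusSix (d : ℕ) : ℤ :=
  if d.Coprime 6 then ArithmeticFunction.moebius d else 0

/-- The number of integers in `[1, k]` divisible neither by `4` nor by `9`. -/
def countFourNine (k : ℕ) : ℕ := ((Finset.Icc 1 k).filter fun m => ¬ 4 ∣ m ∧ ¬ 9 ∣ m).card

/-- Inclusion–exclusion over 4, 9 and 36, arranged without subtraction. The density is 1 - 1/4 - 1/9
+ 1/36 = 2/3. -/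
lemma countFourNine_formula (k : ℕ) :
    countFourNine k + k / 4 + k / 9 = k + k / 36 := by
  induction k with
  | zero => simp [countFourNine]
  | succ k ih =>
    have : countFourNine (k + 1)
        = countFourNine k + if ¬ 4 ∣ (k + 1) ∧ ¬ 9 ∣ (k + 1) then 1 else 0 := by
      unfold countFourNine
      rw [← Finset.insert_Icc_right_eq_Icc_add_one (by omega), Finset.filter_insert]
      split_ifs with h
      · rw [Finset.card_insert_of_notMem (by simp)]
      · rfl
    have h36 : 36 ∣ k + 1 ↔ 4 ∣ k + 1 ∧ 9 ∣ k + 1 :=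
      ⟨fun h => ⟨by omega, by omega⟩, fun h => by omega⟩
    rw [this, Nat.succ_div, Nat.succ_div, Nat.succ_div]
    by_cases h4 : 4 ∣ k + 1 <;> by_cases h9 : 9 ∣ k + 1 <;> simp [h36, h4, h9] <;> omega

/-- The constant bound serves small d; the bound proportional to n/d² serves large d, where the
errors must be summable. -/
lemma countFourNine_error (n d : ℕ) (hd : 0 < d) :
    |(countFourNine (n / d ^ 2) : ℝ) - 2 / 3 * (n / d ^ 2)|
      ≤ min (4 / 3) (2 / 3 * (n / d ^ 2 : ℝ)) := by
  have h := countFourNine_formula (n / d ^ 2)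
  set k := n / d ^ 2 with hk
  have hd2 : (0 : ℝ) < (d : ℝ) ^ 2 := by positivity
  have h1 : (k : ℝ) ≤ n / d ^ 2 := by
    rw [le_div_iff₀ hd2]
    exact_mod_cast Nat.div_mul_le_self n (d ^ 2)
  have h2 : (n / d ^ 2 : ℝ) < k + 1 := by
    rw [div_lt_iff₀ hd2]
    have := Nat.lt_div_mul_add (a := n) (b := d ^ 2) (by positivity)
    have h3 : n < (k + 1) * d ^ 2 := by rw [hk]; linarith
    exact_mod_cast h3
  have a1 : 3 * countFourNine k ≤ 2 * k + 4 := by omega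
  have a2 : 2 * k ≤ 3 * countFourNine k + 2 := by omega
  have a3 : countFourNine k ≤ k := by omega
  have b1 : (3 * countFourNine k : ℝ) ≤ 2 * k + 4 := by exact_mod_cast a1
  have b2 : (2 * k : ℝ) ≤ 3 * countFourNine k + 2 := by exact_mod_cast a2
  have b3 : (countFourNine k : ℝ) ≤ k := by exact_mod_cast a3
  have b4 : (0 : ℝ) ≤ countFourNine k := by positivity
  have b5 : (0 : ℝ) ≤ k := by positivity
  rw [abs_le]
  refine ⟨?_, ?_⟩
  · rw [neg_le, le_min_iff]
    constructor <;> linarith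
  · rw [le_min_iff]
    constructor <;> linarith

/-- Write n = a²b with b squarefree; then d² ∣ n exactly when d ∣ a. If neither 4 nor 9 divides n,
then a is coprime to 6 and the sum is that of μ over the divisors of a, which detects a = 1. -/
lemma sum_moebiusSix_sq_dvd {n K : ℕ} (hn : 0 < n) (hK : n < K) :
    (∑ d ∈ (Finset.range K).filter fun d => d ^ 2 ∣ n, moebiusSix d)
      * (if ¬ 4 ∣ n ∧ ¬ 9 ∣ n then 1 else 0) = if Squarefree n then 1 else 0 := by
  by_cases h : ¬ 4 ∣ n ∧ ¬ 9 ∣ n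
  · rw [if_pos h, mul_one]
    obtain ⟨b, a, hb0, ha0, hab, hb⟩ := Nat.sq_mul_squarefree_of_pos hn
    have hsq : ∀ d, d ^ 2 ∣ n ↔ d ∣ a := by
      intro d
      constructor
      · intro hd
        rw [← hab] at hd
        rw [← Nat.pow_dvd_pow_iff (n := 2) (by norm_num)]
        have hd0 : d ≠ 0 := by rintro rfl; simp at hd; omega
        rw [← Nat.factorization_le_iff_dvd (by positivity) (by positivity)]
        rw [← Nat.factorization_le_iff_dvd (by positivity) (by positivity)] at hd
        intro p
        have h1 := hd p
        have h2 := hb.natFactorization_le_one p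
        rw [Nat.factorization_mul (by positivity) (by omega)] at h1
        simp only [Nat.factorization_pow, Finsupp.smul_apply, Finsupp.add_apply,
          smul_eq_mul] at h1 ⊢
        omega
      · intro hd
        rw [← hab]
        exact (pow_dvd_pow_of_dvd hd 2).mul_right _
    have ha6 : a.Coprime 6 := by
      have h2 : ¬ 2 ∣ a := fun h2 => h.1 ((hsq 2).2 h2)
      have h3 : ¬ 3 ∣ a := fun h3 => h.2 ((hsq 3).2 h3)
      rw [show 6 = 2 * 3 by norm_num]
      exact Nat.Coprime.mul_right
        (((Nat.Prime.coprime_iff_not_dvd Nat.prime_two).2 h2).symm)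
        (((Nat.Prime.coprime_iff_not_dvd Nat.prime_three).2 h3).symm)
    have hset : (Finset.range K).filter (fun d => d ^ 2 ∣ n) = a.divisors := by
      ext d
      simp only [Finset.mem_filter, Finset.mem_range, hsq, Nat.mem_divisors]
      constructor
      · exact fun h => ⟨h.2, by omega⟩
      · intro h
        refine ⟨?_, h.1⟩
        have h1 := Nat.le_of_dvd ha0 h.1
        have h2 : a ≤ n := by rw [← hab]; nlinarith
        omega
    rw [hset]
    have : ∑ d ∈ a.divisors, moebiusSix d
        = ∑ d ∈ a.divisors, ArithmeticFunction.moebius d := by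
      refine Finset.sum_congr rfl fun d hd => ?_
      rw [moebiusSix, if_pos (ha6.coprime_dvd_left (Nat.dvd_of_mem_divisors hd))]
    rw [this, ← ArithmeticFunction.coe_mul_zeta_apply, ArithmeticFunction.moebius_mul_coe_zeta,
      ArithmeticFunction.one_apply]
    congr 1
    rw [eq_iff_iff]
    constructor
    · rintro rfl
      rw [← hab]; simpa using hb
    · intro hs
      have := hs a ⟨b, by rw [← hab]; ring⟩
      simpa using this
  · rw [if_neg h, mul_zero, if_neg]
    intro hs
    apply h
    constructor
    · intro h4
      have := hs 2 (by simpa using h4)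
      simp at this
    · intro h4
      have := hs 3 (by simpa using h4)
      simp at this

/-- Since d² is coprime to 4 and 9, dividing by it does not affect divisibility by either. -/
lemma card_filter_sq_dvd {n d : ℕ} (hd : d.Coprime 6) (hd0 : 0 < d) :
    ((Finset.Icc 1 n).filter fun m => d ^ 2 ∣ m ∧ ¬ 4 ∣ m ∧ ¬ 9 ∣ m).card
      = countFourNine (n / d ^ 2) := by
  symm
  unfold countFourNine
  have hd2 : 0 < d ^ 2 := by positivity
  have c4 : Nat.Coprime 4 (d ^ 2) :=
    (Nat.Coprime.pow_right 2 ((hd.coprime_dvd_right (by norm_num : 2 ∣ 6)).symm.pow_left 2))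
  have c9 : Nat.Coprime 9 (d ^ 2) :=
    (Nat.Coprime.pow_right 2 ((hd.coprime_dvd_right (by norm_num : 3 ∣ 6)).symm.pow_left 2))
  refine Finset.card_bij (fun m _ => d ^ 2 * m) ?_ ?_ ?_
  · intro m hm
    simp only [Finset.mem_filter, Finset.mem_Icc] at hm ⊢
    refine ⟨⟨?_, ?_⟩, dvd_mul_right _ _, fun h => hm.2.1 (c4.dvd_of_dvd_mul_left h),
      fun h => hm.2.2 (c9.dvd_of_dvd_mul_left h)⟩
    · nlinarith [hm.1.1]
    · rw [mul_comm]; exact (Nat.le_div_iff_mul_le hd2).1 hm.1.2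
  · intro a _ b _ h
    exact Nat.eq_of_mul_eq_mul_left hd2 h
  · intro b hb
    simp only [Finset.mem_filter, Finset.mem_Icc] at hb
    obtain ⟨⟨h1, h2⟩, ⟨m, rfl⟩, h4, h9⟩ := hb
    refine ⟨m, ?_, rfl⟩
    simp only [Finset.mem_filter, Finset.mem_Icc]
    refine ⟨⟨?_, ?_⟩, fun h => h4 (h.mul_left _), fun h => h9 (h.mul_left _)⟩
    · rcases Nat.eq_zero_or_pos m with rfl | h
      · simp at h1
      · exact h
    · rw [Nat.le_div_iff_mul_le hd2, mul_comm]; exact h2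

lemma sqfreeCount_eq_sum {n K : ℕ} (hK : n < K) :
    (sqfreeCount n : ℤ) = ∑ d ∈ Finset.range K, moebiusSix d * countFourNine (n / d ^ 2) := by
  have h1 : (sqfreeCount n : ℤ) = ∑ m ∈ Finset.Icc 1 n, if Squarefree m then (1 : ℤ) else 0 := by
    rw [sqfreeCount, Finset.card_filter]; push_cast; rfl
  rw [h1]
  have h2 : ∀ m ∈ Finset.Icc 1 n, (if Squarefree m then (1 : ℤ) else 0)
      = ∑ d ∈ Finset.range K, moebiusSix d * if (d ^ 2 ∣ m ∧ ¬ 4 ∣ m ∧ ¬ 9 ∣ m) then 1 else 0 := by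
    intro m hm
    rw [Finset.mem_Icc] at hm
    rw [← sum_moebiusSix_sq_dvd (K := K) hm.1 (by omega), Finset.sum_filter, Finset.sum_mul]
    refine Finset.sum_congr rfl fun d _ => ?_
    by_cases hd : d ^ 2 ∣ m <;> simp [hd]
  rw [Finset.sum_congr rfl h2, Finset.sum_comm]
  refine Finset.sum_congr rfl fun d _ => ?_
  rw [← Finset.mul_sum]
  by_cases hd : d.Coprime 6
  · have hd0 : 0 < d := by
      rcases Nat.eq_zero_or_pos d with rfl | h
      · norm_num at hd
      · exact h
    rw [← card_filter_sq_dvd hd hd0, Finset.card_filter]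
    push_cast; rfl
  · simp [moebiusSix, hd]

lemma zetaTwo_eq : zetaTwo = Real.pi ^ 2 / 6 := by
  rw [zetaTwo, riemannZeta_two]
  have : ((Real.pi : ℂ) ^ 2 / 6) = ((Real.pi ^ 2 / 6 : ℝ) : ℂ) := by push_cast; rfl
  rw [this, Complex.ofReal_re]

/-- The sum is the inverse of ζ(2) without its Euler factors at 2 and 3, that is, of (1 - 1/4)(1 -
1/9) ζ(2) = (2/3) ζ(2). It is read off the L-series of the trivial character modulo 6. -/
lemma hasSum_moebiusSix :
    HasSum (fun d : ℕ => (moebiusSix d : ℝ) / (d : ℝ) ^ 2) (3 / 2 * (1 / zetaTwo)) := by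
  have key : HasSum (fun d : ℕ => ((moebiusSix d : ℝ) / (d : ℝ) ^ 2 : ℂ))
      ((3 / 2 * (1 / zetaTwo) : ℝ) : ℂ) := by
    have h2 : (1 : ℝ) < (2 : ℂ).re := by norm_num
    have hsum : LSeriesSummable ((fun n : ℕ => (1 : DirichletCharacter ℂ 6) n) *
        fun n : ℕ => ((ArithmeticFunction.moebius n : ℤ) : ℂ)) 2 :=
      DirichletCharacter.LSeriesSummable_mul _
        (ArithmeticFunction.LSeriesSummable_moebius_iff.mpr h2)
    have hv := DirichletCharacter.LSeries.mul_mu_eq_one (1 : DirichletCharacter ℂ 6) h2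
    rw [← DirichletCharacter.LFunction_eq_LSeries _ h2] at hv
    have hL := DirichletCharacter.LFunctionTrivChar_eq_mul_riemannZeta (N := 6) (s := 2)
      (by norm_num)
    have hpf : Nat.primeFactors 6 = {2, 3} := by
      rw [show 6 = 2 * 3 by norm_num, Nat.primeFactors_mul (by norm_num) (by norm_num),
        Nat.Prime.primeFactors Nat.prime_two, Nat.Prime.primeFactors Nat.prime_three]
      rfl
    have hz : riemannZeta 2 = (zetaTwo : ℂ) := by
      rw [riemannZeta_two, zetaTwo_eq]; push_cast; rfl
    have hz0 : (zetaTwo : ℂ) ≠ 0 := by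
      rw [zetaTwo_eq]; exact_mod_cast (by positivity : Real.pi ^ 2 / 6 ≠ 0)
    have e2 : ∀ x : ℂ, x ^ (-2 : ℂ) = (x ^ 2)⁻¹ := by
      intro x
      rw [Complex.cpow_neg]
      norm_num
    rw [hpf, Finset.prod_pair (by norm_num), hz, e2, e2] at hL
    norm_num at hL
    unfold DirichletCharacter.LFunctionTrivChar at hL
    rw [hL] at hv
    have hS := hsum.LSeriesHasSum
    rw [LSeriesHasSum] at hS
    have hval : ((3 / 2 * (1 / zetaTwo) : ℝ) : ℂ) = LSeries ((fun n : ℕ =>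
        (1 : DirichletCharacter ℂ 6) n) *
        fun n : ℕ => ((ArithmeticFunction.moebius n : ℤ) : ℂ)) 2 := by
      have : LSeries ((fun n : ℕ => (1 : DirichletCharacter ℂ 6) n) *
        fun n : ℕ => ((ArithmeticFunction.moebius n : ℤ) : ℂ)) 2 = 1 / (2 / 3 * zetaTwo) := by
        rw [eq_div_iff (by simpa using hz0), mul_comm]
        exact hv
      rw [this]
      push_cast
      field_simp
    rw [hval]
    convert hS using 2 with d
    rcases Nat.eq_zero_or_pos d with rfl | hd
    · simp [moebiusSix]
    · rw [LSeries.term_of_ne_zero (by omega)]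
      simp only [Pi.mul_apply, moebiusSix]
      by_cases h6 : d.Coprime 6
      · rw [MulChar.one_apply ((ZMod.isUnit_iff_coprime d 6).2 h6), if_pos h6]
        norm_num
      · rw [MulChar.map_nonunit _ (fun h => h6 ((ZMod.isUnit_iff_coprime d 6).1 h)), if_neg h6]
        simp
  have := Complex.hasSum_re key
  rw [Complex.ofReal_re] at this
  convert this using 2 with d
  have : ((moebiusSix d : ℝ) / (d : ℝ) ^ 2 : ℂ) = ((((moebiusSix d : ℝ) / (d : ℝ) ^ 2) : ℝ) : ℂ) := by
    push_cast; rfl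
  rw [this, Complex.ofReal_re]

lemma sum_coprime_six (φ : ℕ → ℝ) (k : ℕ) :
    ∑ d ∈ Finset.range (6 * k), (if d.Coprime 6 then φ d else 0)
      = ∑ i ∈ Finset.range k, (φ (6 * i + 1) + φ (6 * i + 5)) := by
  induction k with
  | zero => simp
  | succ k ih =>
    have e : ∀ r, Nat.Coprime (6 * k + r) 6 ↔ Nat.Coprime r 6 := by
      intro r; rw [add_comm]; simp
    rw [show 6 * (k + 1) = 6 * k + 6 by ring, Finset.sum_range_add, ih, Finset.sum_range_succ]
    simp only [e, Finset.sum_range_succ, Finset.sum_range_zero]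
    norm_num

/-- Telescoping: the i-th block is at most 1/(3(6i - 1)) - 1/(3(6i + 5)). -/
lemma sum_coprime_six_tail {j : ℕ} (hj : 1 ≤ j) (k : ℕ) :
    ∑ i ∈ Finset.Ico j k, (1 / ((6 * i + 1 : ℕ) : ℝ) ^ 2 + 1 / ((6 * i + 5 : ℕ) : ℝ) ^ 2)
      ≤ 1 / (3 * (6 * (j : ℝ) - 1)) := by
  rcases le_total k j with h | h
  · rw [Finset.Ico_eq_empty (by omega), Finset.sum_empty]
    have : (1 : ℝ) ≤ j := by exact_mod_cast hj
    apply div_nonneg <;> linarith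
  · have : ∑ i ∈ Finset.Ico j k,
        (1 / ((6 * i + 1 : ℕ) : ℝ) ^ 2 + 1 / ((6 * i + 5 : ℕ) : ℝ) ^ 2)
        ≤ 1 / (3 * (6 * (j : ℝ) - 1)) - 1 / (3 * (6 * (k : ℝ) - 1)) := by
      induction k, h using Nat.le_induction with
      | base => simp
      | succ k hk ih =>
        rw [Finset.sum_Ico_succ_top hk]
        have hk1 : (1 : ℝ) ≤ k := by exact_mod_cast hj.trans hk
        have : 1 / ((6 * k + 1 : ℕ) : ℝ) ^ 2 + 1 / ((6 * k + 5 : ℕ) : ℝ) ^ 2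
            ≤ 1 / (3 * (6 * (k : ℝ) - 1)) - 1 / (3 * (6 * ((k + 1 : ℕ) : ℝ) - 1)) := by
          push_cast
          have h1 : (0 : ℝ) < 6 * k - 1 := by linarith
          have h2 : (6 * ((k : ℝ) + 1) - 1) = 6 * k + 5 := by ring
          rw [h2, div_sub_div _ _ (by positivity) (by positivity),
            div_add_div _ _ (by positivity) (by positivity),
            div_le_div_iff₀ (by positivity) (by positivity)]
          -- In the variable k - 1 all coefficients of the cleared inequality are non-negative.
          obtain ⟨y, hy⟩ : ∃ y : ℝ, (k : ℝ) = y + 1 := ⟨k - 1, by ring⟩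
          have hy0 : 0 ≤ y := by linarith
          rw [hy, ← sub_nonneg]
          ring_nf
          positivity
        linarith
    have hk1 : (1 : ℝ) ≤ k := by exact_mod_cast hj.trans h
    have : (0 : ℝ) ≤ 1 / (3 * (6 * (k : ℝ) - 1)) := by
      apply div_nonneg <;> linarith
    linarith

/-- For d < 6j each of the 2j integers coprime to 6 costs 4/3; beyond that the error is (2/3) n/d²
and the tail bound applies. The estimate is proved for every long partial sum and passed to the
limit. -/
lemma sqfreeCount_le_split (n : ℕ) {j : ℕ} (hj : 1 ≤ j) :
    (sqfreeCount n : ℝ) ≤ n * (1 / zetaTwo) + 8 / 3 * j + 2 * n / (9 * (6 * j - 1)) := by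
  have hj1 : (1 : ℝ) ≤ j := by exact_mod_cast hj
  have hlim : Tendsto (fun k : ℕ => 2 / 3 * (n : ℝ) *
      ∑ d ∈ Finset.range (6 * k), (moebiusSix d : ℝ) / (d : ℝ) ^ 2
      + (8 / 3 * j + 2 * n / (9 * (6 * j - 1)))) atTop
      (𝓝 (2 / 3 * (n : ℝ) * (3 / 2 * (1 / zetaTwo)) + (8 / 3 * j + 2 * n / (9 * (6 * j - 1))))) := by
    refine Tendsto.add_const _ (Tendsto.const_mul _ ?_)
    exact hasSum_moebiusSix.tendsto_sum_nat.comp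
      (tendsto_atTop_mono (fun k => by simp only [id]; omega) tendsto_id)
  have := ge_of_tendsto hlim (b := (sqfreeCount n : ℝ)) ?_
  · calc _ ≤ _ := this
      _ = _ := by ring
  filter_upwards [eventually_ge_atTop (n + j + 1)] with k hk
  have h1 : (sqfreeCount n : ℝ)
      = ∑ d ∈ Finset.range (6 * k), (moebiusSix d : ℝ) * countFourNine (n / d ^ 2) := by
    exact_mod_cast congrArg (Int.cast (R := ℝ)) (sqfreeCount_eq_sum (n := n) (K := 6 * k) (by omega))
  set φ : ℕ → ℝ := fun d => min (4 / 3) (2 / 3 * (n / d ^ 2 : ℝ)) with hφ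
  have h2 : ∀ d ∈ Finset.range (6 * k), (moebiusSix d : ℝ) * countFourNine (n / d ^ 2)
      ≤ 2 / 3 * n * ((moebiusSix d : ℝ) / (d : ℝ) ^ 2) + if d.Coprime 6 then φ d else 0 := by
    intro d _
    by_cases hd : d.Coprime 6
    · have hd0 : 0 < d := by
        rcases Nat.eq_zero_or_pos d with rfl | h
        · norm_num at hd
        · exact h
      rw [if_pos hd]
      have e := countFourNine_error n d hd0
      have hm : |(moebiusSix d : ℝ)| ≤ 1 := by
        rw [moebiusSix, if_pos hd]
        exact_mod_cast ArithmeticFunction.abs_moebius_le_one (n := d)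
      have : (moebiusSix d : ℝ) * ((countFourNine (n / d ^ 2) : ℝ) - 2 / 3 * (n / d ^ 2)) ≤ φ d := by
        refine (le_abs_self _).trans ?_
        rw [abs_mul]
        calc _ ≤ 1 * |(countFourNine (n / d ^ 2) : ℝ) - 2 / 3 * (n / d ^ 2)| :=
              mul_le_mul_of_nonneg_right hm (abs_nonneg _)
          _ ≤ _ := by rw [one_mul]; exact e
      have e2 : 2 / 3 * (n : ℝ) * ((moebiusSix d : ℝ) / (d : ℝ) ^ 2)
        = (moebiusSix d : ℝ) * (2 / 3 * (n / d ^ 2)) := by ring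
      rw [e2]; linarith
    · simp [moebiusSix, hd]
  have h3 := Finset.sum_le_sum h2
  rw [← h1, Finset.sum_add_distrib, ← Finset.mul_sum, sum_coprime_six] at h3
  refine h3.trans (add_le_add_right ?_ _)
  rw [← Finset.sum_range_add_sum_Ico _ (show j ≤ k by omega)]
  refine add_le_add ?_ ?_
  · calc _ ≤ ∑ i ∈ Finset.range j, (8 / 3 : ℝ) := by
          refine Finset.sum_le_sum fun i _ => ?_
          have a1 : φ (6 * i + 1) ≤ 4 / 3 := min_le_left _ _
          have a2 : φ (6 * i + 5) ≤ 4 / 3 := min_le_left _ _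
          linarith
      _ = _ := by simp; ring
  · calc _ ≤ ∑ i ∈ Finset.Ico j k, (2 / 3 * (n : ℝ)) *
          (1 / ((6 * i + 1 : ℕ) : ℝ) ^ 2 + 1 / ((6 * i + 5 : ℕ) : ℝ) ^ 2) := by
          refine Finset.sum_le_sum fun i _ => ?_
          have a1 : φ (6 * i + 1) ≤ 2 / 3 * (n / ((6 * i + 1 : ℕ) : ℝ) ^ 2) := min_le_right _ _
          have a2 : φ (6 * i + 5) ≤ 2 / 3 * (n / ((6 * i + 5 : ℕ) : ℝ) ^ 2) := min_le_right _ _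
          calc _ ≤ _ := add_le_add a1 a2
            _ = _ := by ring
      _ ≤ (2 / 3 * (n : ℝ)) * (1 / (3 * (6 * j - 1))) := by
          rw [← Finset.mul_sum]
          exact mul_le_mul_of_nonneg_left (sum_coprime_six_tail hj k) (by positivity)
      _ = _ := by
          have : (6 * (j : ℝ) - 1) ≠ 0 := by linarith
          field_simp; ring

lemma inv_zetaTwo_bounds : (0.6079 : ℝ) < 1 / zetaTwo ∧ 1 / zetaTwo < (0.608 : ℝ) := by
  rw [zetaTwo_eq]
  have h1 := Real.pi_gt_d4
  have h2 := Real.pi_lt_d4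
  have hp : 0 < Real.pi ^ 2 / 6 := by positivity
  rw [lt_div_iff₀ hp, div_lt_iff₀ hp]
  constructor <;> nlinarith

/-- With z = 6j - 1 the error is 4(z + 1)/9 + 2n/(9z), minimal at z = t = √(n/2). The floor chosen
for j puts z within 3 of t, and the error, about 8t/9, stays below 0.96t. -/
lemma sqfreeCount_le_of_large {n : ℕ} (hn : 400 ≤ n) :
    (sqfreeCount n : ℝ) ≤ n * (1 / zetaTwo) + √3 * (1 - 1 / zetaTwo) * √n := by
  obtain ⟨hu1, hu2⟩ := inv_zetaTwo_bounds
  set t := √((n : ℝ) / 2) with ht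
  have hn' : (400 : ℝ) ≤ n := by exact_mod_cast hn
  have ht2 : t ^ 2 = n / 2 := Real.sq_sqrt (by positivity)
  have ht14 : 14 ≤ t := Real.le_sqrt_of_sq_le (by linarith)
  set j := ⌊(t + 4) / 6⌋₊ with hj
  have hj1 : 1 ≤ j := Nat.le_floor (by push_cast; linarith)
  have j1 : (j : ℝ) ≤ (t + 4) / 6 := Nat.floor_le (by positivity)
  have j2 : (t + 4) / 6 < j + 1 := Nat.lt_floor_add_one _
  have hb := sqfreeCount_le_split n hj1
  have h6 : 2.449 * t ≤ √3 * √n := by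
    rw [← Real.sqrt_mul (by norm_num)]
    apply Real.le_sqrt_of_sq_le
    rw [mul_pow, ht2]; nlinarith
  have hmain : 8 / 3 * (j : ℝ) + 2 * n / (9 * (6 * j - 1)) ≤ 0.96 * t := by
    obtain ⟨z, hz⟩ : ∃ z : ℝ, z = 6 * j - 1 := ⟨_, rfl⟩
    have z1 : t - 3 ≤ z := by linarith
    have z2 : z ≤ t + 3 := by linarith
    have z0 : 0 < z := by linarith
    have : (n : ℝ) = 2 * t ^ 2 := by linarith
    rw [← hz, this, show (j : ℝ) = (z + 1) / 6 by linarith]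
    have e : 8 / 3 * ((z + 1) / 6) + 2 * (2 * t ^ 2) / (9 * z)
        = 4 / 9 * (1 + 2 * t + (z - t) ^ 2 / z) := by
      field_simp; ring
    rw [e]
    have : (z - t) ^ 2 / z ≤ 9 / 11 := by
      rw [div_le_div_iff₀ z0 (by norm_num)]
      nlinarith
    nlinarith
  have h7 : 0.96 * t ≤ √3 * (1 - 1 / zetaTwo) * √n := by
    calc 0.96 * t ≤ 2.449 * t * (1 - 1 / zetaTwo) := by nlinarith
      _ ≤ (√3 * √n) * (1 - 1 / zetaTwo) := mul_le_mul_of_nonneg_right h6 (by linarith)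
      _ = _ := by ring
  linarith

/-! ### Small arguments by computation, and the bound for the squarefree count. -/

/-- Divisibility test by the squares of the primes below `20`. -/
def sqfreeTest (n : ℕ) : Bool :=
  n % 4 != 0 && n % 9 != 0 && n % 25 != 0 && n % 49 != 0 && n % 121 != 0 && n % 169 != 0 &&
    n % 289 != 0 && n % 361 != 0

/-- The number of integers in `[1, n]` passing `sqfreeTest`. -/
def testCount : ℕ → ℕ
  | 0 => 0
  | n + 1 => testCount n + (sqfreeTest (n + 1)).toNat

/-- An integer upper bound for `10 ^ 9` times the sum of reciprocals of squarefree integers. -/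
def testRecip : ℕ → ℕ
  | 0 => 0
  | n + 1 => testRecip n + (sqfreeTest (n + 1)).toNat * (10 ^ 9 / (n + 1) + 1)

/-- An integer lower bound for `10 ^ 9 * log n`, for `n ≥ 3`. -/
def logLower : ℕ → ℕ
  | 0 => 0
  -- Three equal increments make `logLower 3` equal to 1098570000, justified by log 3 > 1.09857;
  -- later increments come from log(1 + 1/n) ≥ 2/(2n + 1).
  | n + 1 => logLower n + if n < 3 then 366190000 else 2 * 10 ^ 9 / (2 * n + 1)

/-- The bound for the count, squared and scaled, with 0.6079 for 1/ζ(2). Truncated subtraction makes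
it trivial when the count is below 0.6079 n. -/
lemma testCount_check : ∀ n < 400, 4 ≤ n →
    (10000 * testCount n - 6079 * n) ^ 2 ≤ 3 * n * 3921 ^ 2 := by decide +kernel

lemma testRecip_check : ∀ n < 257, 3 ≤ n →
    10000 * testRecip n ≤ 6079 * logLower n + 11660 * 10 ^ 9 := by decide +kernel

lemma testCount_256 : testCount 256 = 157 := by decide +kernel

lemma testRecip_256 : testRecip 256 ≤ 4416520000 := by decide +kernel

/-- The sum of the reciprocals of the squarefree integers in `[1, n]`. -/
noncomputable def sqfreeRecip (n : ℕ) : ℝ :=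
  ∑ l ∈ (Finset.Icc 1 n).filter Squarefree, 1 / (l : ℝ)

lemma sqfreeTest_of_squarefree {n : ℕ} (h : Squarefree n) : sqfreeTest n = true := by
  have key : ∀ p, 2 ≤ p → n % (p * p) ≠ 0 := by
    intro p hp h0
    have := h p (Nat.dvd_of_mod_eq_zero h0)
    rw [Nat.isUnit_iff] at this
    omega
  have := key 2; have := key 3; have := key 5; have := key 7
  have := key 11; have := key 13; have := key 17; have := key 19
  simp_all [sqfreeTest]

/-- The first prime not tested is 23, and 23² = 529. -/
lemma squarefree_of_sqfreeTest {n : ℕ} (hn0 : 0 < n) (hn : n < 529) (h : sqfreeTest n = true) :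
    Squarefree n := by
  rw [Nat.squarefree_iff_prime_squarefree]
  rintro p hp hd
  have h1 : p * p ≤ n := Nat.le_of_dvd hn0 hd
  have h2 : p < 23 := by nlinarith
  simp only [sqfreeTest, Bool.and_eq_true, bne_iff_ne, ne_eq] at h
  have h3 := hp.two_le
  have hm := Nat.mod_eq_zero_of_dvd hd
  interval_cases p <;> first | (simp_all; done) | (exact absurd hp (by norm_num))

lemma sqfreeCount_succ (n : ℕ) :
    sqfreeCount (n + 1) = sqfreeCount n + if Squarefree (n + 1) then 1 else 0 := by
  unfold sqfreeCount
  rw [← Finset.insert_Icc_right_eq_Icc_add_one (by omega), Finset.filter_insert]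
  split_ifs with h
  · rw [Finset.card_insert_of_notMem (by simp)]
  · rfl

lemma sqfreeRecip_succ (n : ℕ) :
    sqfreeRecip (n + 1)
      = sqfreeRecip n + if Squarefree (n + 1) then 1 / ((n : ℝ) + 1) else 0 := by
  unfold sqfreeRecip
  rw [← Finset.insert_Icc_right_eq_Icc_add_one (by omega), Finset.filter_insert]
  split_ifs with h
  · rw [Finset.sum_insert (by simp), add_comm]; push_cast; rfl
  · simp

lemma sqfreeCount_le_testCount (n : ℕ) : sqfreeCount n ≤ testCount n := by
  induction n with
  | zero => simp [sqfreeCount]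
  | succ n ih =>
    rw [sqfreeCount_succ, testCount]
    split_ifs with h
    · rw [sqfreeTest_of_squarefree h, Bool.toNat_true]; omega
    · omega

lemma testCount_eq_sqfreeCount {n : ℕ} (hn : n < 529) : sqfreeCount n = testCount n := by
  induction n with
  | zero => simp [sqfreeCount, testCount]
  | succ n ih =>
    rw [sqfreeCount_succ, testCount, ih (by omega)]
    split_ifs with h
    · rw [sqfreeTest_of_squarefree h, Bool.toNat_true]
    · have : sqfreeTest (n + 1) = false := by
        by_contra hc
        exact h (squarefree_of_sqfreeTest (by omega) hn (by simpa using hc))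
      rw [this, Bool.toNat_false]

lemma sqfreeRecip_le_testRecip (n : ℕ) : sqfreeRecip n * 10 ^ 9 ≤ testRecip n := by
  induction n with
  | zero => simp [sqfreeRecip, testRecip]
  | succ n ih =>
    rw [sqfreeRecip_succ, testRecip]
    split_ifs with h
    · rw [sqfreeTest_of_squarefree h, Bool.toNat_true, one_mul]
      push_cast
      have h1 := Nat.lt_div_mul_add (a := 10 ^ 9) (b := n + 1) (by omega)
      have h2 : ((10 ^ 9 : ℕ) : ℝ) < ((10 ^ 9 / (n + 1) * (n + 1) + (n + 1) : ℕ) : ℝ) := by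
        exact_mod_cast h1
      push_cast at h2
      have h3 : (1 / ((n : ℝ) + 1)) * 10 ^ 9 ≤ ((10 ^ 9 / (n + 1) : ℕ) : ℝ) + 1 := by
        rw [div_mul_eq_mul_div, div_le_iff₀ (by positivity)]
        push_cast; linarith
      push_cast at h3
      linarith
    · push_cast
      have : (0 : ℝ) ≤ ((sqfreeTest (n + 1)).toNat : ℝ) * (((10 ^ 9 / (n + 1) : ℕ) : ℝ) + 1) := by
        positivity
      push_cast at this
      linarith

lemma two_div_le_log_succ {n : ℕ} (hn : 1 ≤ n) :
    2 / (2 * (n : ℝ) + 1) ≤ Real.log (n + 1) - Real.log n := by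
  have hn' : (0 : ℝ) < n := by exact_mod_cast hn
  rw [← Real.log_div (by positivity) (by positivity)]
  have := Real.le_log_one_add_of_nonneg (x := 1 / n) (by positivity)
  have e : 2 * (1 / (n : ℝ)) / (1 / n + 2) = 2 / (2 * (n : ℝ) + 1) := by
    field_simp; ring
  have e2 : 1 + 1 / (n : ℝ) = (n + 1) / n := by field_simp
  rw [e, e2] at this
  exact this

lemma log_three_gt : (1.09857 : ℝ) < Real.log 3 := by
  have h := Real.log_two_gt_d9
  -- 84/53 is a continued fraction convergent of log 3 / log 2, from below.
  have h1 : Real.log ((2 : ℝ) ^ 84) ≤ Real.log ((3 : ℝ) ^ 53) :=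
    Real.log_le_log (by positivity) (by norm_num)
  rw [Real.log_pow, Real.log_pow] at h1
  push_cast at h1
  linarith

lemma logLower_le {n : ℕ} (hn : 3 ≤ n) : (logLower n : ℝ) ≤ 10 ^ 9 * Real.log n := by
  induction n, hn using Nat.le_induction with
  | base =>
    have := log_three_gt
    norm_num [logLower]
    linarith
  | succ n hn ih =>
    rw [logLower, if_neg (by omega)]
    have h1 := two_div_le_log_succ (n := n) (by omega)
    have h2 : ((2 * 10 ^ 9 / (2 * n + 1) : ℕ) : ℝ) ≤ 10 ^ 9 * (2 / (2 * (n : ℝ) + 1)) := by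
      refine Nat.cast_div_le.trans (le_of_eq ?_)
      push_cast; ring
    rw [Nat.cast_add]
    push_cast at h2 ⊢
    nlinarith

/-- The constant √3 (1 - 1/ζ(2)) is forced by n = 3, where both sides equal 3. -/
theorem sqfreeCount_le (n : ℕ) :
    (sqfreeCount n : ℝ) ≤ n * (1 / zetaTwo) + √3 * (1 - 1 / zetaTwo) * √n := by
  obtain ⟨hu1, hu2⟩ := inv_zetaTwo_bounds
  rcases le_or_gt 400 n with h | h
  · exact sqfreeCount_le_of_large h
  have s3 : (1.732 : ℝ) ≤ √3 := Real.le_sqrt_of_sq_le (by norm_num)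
  rcases le_or_gt 4 n with h4 | h4
  · have hc := testCount_check n h h4
    have hle := sqfreeCount_le_testCount n
    rw [mul_right_comm, ← Real.sqrt_mul (by norm_num)]
    have hs2 : √(3 * (n : ℝ)) ^ 2 = 3 * n := Real.sq_sqrt (by positivity)
    have hs0 : 0 ≤ √(3 * (n : ℝ)) := Real.sqrt_nonneg _
    -- Because √(3n) ≤ n, the right-hand side increases with 1/ζ(2), which may therefore be replaced
    -- by the smaller 0.6079.
    have hsn : √(3 * (n : ℝ)) ≤ n := by
      rw [Real.sqrt_le_left (by positivity)]
      have : (4 : ℝ) ≤ n := by exact_mod_cast h4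
      nlinarith
    have hq : (sqfreeCount n : ℝ) ≤ testCount n := by exact_mod_cast hle
    have key : 10000 * (testCount n : ℝ) ≤ 6079 * n + 3921 * √(3 * (n : ℝ)) := by
      rcases le_total (10000 * testCount n) (6079 * n) with h5 | h5
      · have : (10000 * testCount n : ℝ) ≤ 6079 * n := by exact_mod_cast h5
        linarith
      · have hc' : (10000 * (testCount n : ℝ) - 6079 * n) ^ 2 ≤ 3 * n * 3921 ^ 2 := by
          have := (Nat.cast_le (α := ℝ)).2 hc
          rw [Nat.cast_pow, Nat.cast_sub h5] at this
          push_cast at this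
          linarith
        have : 10000 * (testCount n : ℝ) - 6079 * n ≤ 3921 * √(3 * (n : ℝ)) := by
          apply le_of_sq_le_sq _ (by positivity)
          rw [mul_pow, hs2]; linarith
        linarith
    nlinarith
  · interval_cases n
    · simp [sqfreeCount]
    · rw [testCount_eq_sqfreeCount (by norm_num), show testCount 1 = 1 by decide +kernel]
      push_cast
      rw [Real.sqrt_one]
      nlinarith
    · rw [testCount_eq_sqfreeCount (by norm_num), show testCount 2 = 2 by decide +kernel]
      have s2 : (1.414 : ℝ) ≤ √2 := Real.le_sqrt_of_sq_le (by norm_num)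
      have : 1.732 * 1.414 ≤ √3 * √2 := mul_le_mul s3 s2 (by norm_num) (by positivity)
      push_cast
      nlinarith
    · rw [testCount_eq_sqfreeCount (by norm_num), show testCount 3 = 3 by decide +kernel]
      have : √3 * √3 = 3 := Real.mul_self_sqrt (by norm_num)
      push_cast
      nlinarith

/-! ### The sum of reciprocals of squarefree integers. -/

/-- Partial summation in incremental form: R(n) - Q(n)/n does not see whether n + 1 is squarefree
except through Q(n). -/
lemma sqfreeRecip_sub_succ {n : ℕ} (hn : 1 ≤ n) :
    sqfreeRecip (n + 1) - sqfreeCount (n + 1) / ((n : ℝ) + 1)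
      = sqfreeRecip n - sqfreeCount n / (n : ℝ) + sqfreeCount n / ((n : ℝ) * (n + 1)) := by
  have hn' : (0 : ℝ) < n := by exact_mod_cast hn
  rw [sqfreeRecip_succ, sqfreeCount_succ]
  split_ifs <;> push_cast <;> field_simp <;> ring

/-- A discrete version of the integral of t^(-3/2), used to telescope the √n part of the bound for
Q. -/
lemma inv_sqrt_mul_succ_le {n : ℕ} (hn : 1 ≤ n) :
    √(n : ℝ) / ((n : ℝ) * (n + 1)) ≤ 2 / √(n : ℝ) - 2 / √((n : ℝ) + 1) := by
  have hn' : (0 : ℝ) < n := by exact_mod_cast hn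
  set a := √(n : ℝ) with ha
  set b := √((n : ℝ) + 1) with hb
  have a2 : a ^ 2 = n := Real.sq_sqrt (by positivity)
  have b2 : b ^ 2 = n + 1 := Real.sq_sqrt (by positivity)
  have a0 : 0 < a := Real.sqrt_pos.2 hn'
  have b0 : 0 < b := Real.sqrt_pos.2 (by positivity)
  have hab : a ≤ b := Real.sqrt_le_sqrt (by linarith)
  rw [← b2, ← a2, div_sub_div _ _ a0.ne' b0.ne', div_le_div_iff₀ (by positivity) (by positivity)]
  have h1 : b ^ 2 - a ^ 2 = 1 := by rw [a2, b2]; ring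
  have h2 : (b - a) * (b + a) = 1 := by linarith
  have h3 : 1 ≤ 2 * b * (b - a) := by nlinarith
  have h4 : 0 ≤ a ^ 2 * b := by positivity
  calc a * (a * b) = (a ^ 2 * b) * 1 := by ring
    _ ≤ (a ^ 2 * b) * (2 * b * (b - a)) := mul_le_mul_of_nonneg_left h3 h4
    _ = _ := by ring

theorem sqfreeRecip_le {n : ℕ} (hn : 1 ≤ n) :
    sqfreeRecip n ≤ 1 / zetaTwo * Real.log n + 1.166 := by
  obtain ⟨hu1, hu2⟩ := inv_zetaTwo_bounds
  obtain ⟨u, hu⟩ : ∃ u, u = 1 / zetaTwo := ⟨_, rfl⟩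
  rw [← hu] at hu1 hu2 ⊢
  rcases le_or_gt 256 n with h | h
  · set c := √3 * (1 - u) with hc
    have c1 : c ≤ 0.6792 := by
      have : √3 ≤ 1.73206 := by
        rw [Real.sqrt_le_left (by norm_num)]; norm_num
      rw [hc]; nlinarith
    have c0 : 0 ≤ c := hc ▸ mul_nonneg (Real.sqrt_nonneg _) (by linarith)
    -- The reserve -2c/√n absorbs the √n errors accumulated in the induction; at the end it also
    -- covers the c/√n in Q(n)/n ≤ u + c/√n. The start at 256 is numerical.
    have key : sqfreeRecip n - sqfreeCount n / (n : ℝ) ≤ u * Real.log n + (1.166 - u)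
        - 2 * c / √(n : ℝ) := by
      induction n, h using Nat.le_induction with
      | base =>
        have e1 := sqfreeRecip_le_testRecip 256
        have e2 : ((testRecip 256 : ℕ) : ℝ) ≤ 4416520000 := by exact_mod_cast testRecip_256
        rw [testCount_eq_sqfreeCount (by norm_num), testCount_256]
        have l2 := Real.log_two_gt_d9
        have e3 : Real.log ((256 : ℕ) : ℝ) = 8 * Real.log 2 := by
          rw [show ((256 : ℕ) : ℝ) = 2 ^ 8 by norm_num, Real.log_pow]; norm_num
        have e4 : √((256 : ℕ) : ℝ) = 16 := by
          rw [show ((256 : ℕ) : ℝ) = 16 ^ 2 by norm_num, Real.sqrt_sq (by norm_num)]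
        rw [e3, e4]
        push_cast
        nlinarith
      | succ n hn' ih =>
        have ih := ih (by omega)
        have h1 : 1 ≤ n := by omega
        have hn0 : (0 : ℝ) < n := by exact_mod_cast h1
        have hs := sqfreeRecip_sub_succ h1
        have hq := sqfreeCount_le n
        rw [← hu, ← hc] at hq
        have hs2 := inv_sqrt_mul_succ_le h1
        have hl := two_div_le_log_succ h1
        have hl' : 1 / ((n : ℝ) + 1) ≤ Real.log (n + 1) - Real.log n := by
          refine le_trans ?_ hl
          rw [div_le_div_iff₀ (by positivity) (by positivity)]; linarith
        have hq2 : (sqfreeCount n : ℝ) / ((n : ℝ) * (n + 1))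
            ≤ u * (1 / ((n : ℝ) + 1)) + c * (√(n : ℝ) / ((n : ℝ) * (n + 1))) := by
          have e : u * (1 / ((n : ℝ) + 1)) + c * (√(n : ℝ) / ((n : ℝ) * (n + 1)))
              = (n * u + c * √n) / ((n : ℝ) * (n + 1)) := by field_simp
          rw [e]
          exact div_le_div_of_nonneg_right hq (by positivity)
        have h5 := mul_le_mul_of_nonneg_left hl' (show 0 ≤ u by linarith)
        have h6 := mul_le_mul_of_nonneg_left hs2 c0
        push_cast
        rw [hs]
        have e6 : c * (2 / √(n : ℝ) - 2 / √((n : ℝ) + 1))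
          = 2 * c / √(n : ℝ) - 2 * c / √((n : ℝ) + 1) := by ring
        rw [e6] at h6
        linarith
    have hn0 : (0 : ℝ) < n := by exact_mod_cast hn
    have hq : (sqfreeCount n : ℝ) / n ≤ u + c / √(n : ℝ) := by
      rw [div_le_iff₀ hn0]
      refine (sqfreeCount_le n).trans (le_of_eq ?_)
      rw [← hu, ← hc]
      have : √(n : ℝ) * √n = n := Real.mul_self_sqrt hn0.le
      have h0 : √(n : ℝ) ≠ 0 := (Real.sqrt_pos.2 hn0).ne'
      field_simp
      linear_combination c * this
    have : 2 * c / √(n : ℝ) = c / √(n : ℝ) + c / √(n : ℝ) := by ring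
    have : 0 ≤ c / √(n : ℝ) := by positivity
    linarith
  · have hle := sqfreeRecip_le_testRecip n
    rcases le_or_gt 3 n with h3 | h3
    · have hc := testRecip_check n (by omega) h3
      have hc' : (10000 * testRecip n : ℝ) ≤ 6079 * logLower n + 11660 * 10 ^ 9 := by
        exact_mod_cast hc
      have hl := logLower_le h3
      have hlog : 0 ≤ Real.log n := Real.log_natCast_nonneg n
      nlinarith
    · have l2 := Real.log_two_gt_d9
      interval_cases n
      · have : ((testRecip 1 : ℕ) : ℝ) ≤ 1000000001 := by
          exact_mod_cast (by decide +kernel : testRecip 1 ≤ 1000000001)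
        norm_num; linarith
      · have : ((testRecip 2 : ℕ) : ℝ) ≤ 1500000002 := by
          exact_mod_cast (by decide +kernel : testRecip 2 ≤ 1500000002)
        push_cast
        nlinarith

/-! ### The Kronecker symbol and its convolution with μ². -/

lemma kroneckerSym_zero (δ : ℤ) : kroneckerSym (4 * δ) 0 = 0 := by
  rw [kroneckerSym, if_pos rfl, if_neg]
  rw [Int.natAbs_mul]
  intro h
  have := Nat.eq_one_of_mul_eq_one_right h
  norm_num at this

lemma kroneckerSym_even (δ : ℤ) {n : ℕ} (hn : Even n) : kroneckerSym (4 * δ) n = 0 := by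
  rcases Nat.eq_zero_or_pos n with rfl | h0
  · exact kroneckerSym_zero δ
  rw [kroneckerSym, if_neg (by omega)]
  have hf : n.factorization 2 ≠ 0 := by
    have := (Nat.Prime.dvd_iff_one_le_factorization Nat.prime_two (by omega : n ≠ 0)).1 hn.two_dvd
    omega
  have : ZMod.χ₈ ((4 * δ : ℤ) : ZMod 8) = 0 := by
    push_cast
    generalize (δ : ZMod 8) = x
    revert x
    decide
  rw [this, zero_pow hf, zero_mul]

lemma kroneckerSym_odd (δ : ℤ) {n : ℕ} (hn : Odd n) :
    kroneckerSym (4 * δ) n = jacobiSym δ n := by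
  have h0 : n ≠ 0 := hn.pos.ne'
  rw [kroneckerSym, if_neg h0]
  have hf : n.factorization 2 = 0 :=
    Nat.factorization_eq_zero_of_not_dvd (fun h => (Nat.not_even_iff_odd.2 hn) (even_iff_two_dvd.2 h))
  rw [hf, pow_zero, pow_zero, one_mul, Nat.div_one, jacobiSym.mul_left, jacobiSym.at_four hn, one_mul]

lemma kroneckerSym_one (δ : ℤ) : kroneckerSym (4 * δ) 1 = 1 := by
  rw [kroneckerSym_odd δ odd_one, jacobiSym.one_right]

lemma kroneckerSym_mul (δ : ℤ) (m n : ℕ) :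
    kroneckerSym (4 * δ) (m * n) = kroneckerSym (4 * δ) m * kroneckerSym (4 * δ) n := by
  rcases Nat.even_or_odd m with hm | hm
  · rw [kroneckerSym_even δ hm, kroneckerSym_even δ (hm.mul_right n), zero_mul]
  rcases Nat.even_or_odd n with hn | hn
  · rw [kroneckerSym_even δ hn, kroneckerSym_even δ (hn.mul_left m), mul_zero]
  rw [kroneckerSym_odd δ hm, kroneckerSym_odd δ hn, kroneckerSym_odd δ (hm.mul hn)]
  exact jacobiSym.mul_right' _ hm.pos.ne' hn.pos.ne'

lemma kroneckerSym_pow (δ : ℤ) (m k : ℕ) :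
    kroneckerSym (4 * δ) (m ^ k) = kroneckerSym (4 * δ) m ^ k := by
  induction k with
  | zero => simp [kroneckerSym_one]
  | succ k ih => rw [pow_succ, pow_succ, kroneckerSym_mul, ih]

lemma kroneckerSym_trichotomy (δ : ℤ) (n : ℕ) :
    kroneckerSym (4 * δ) n = 0 ∨ kroneckerSym (4 * δ) n = 1 ∨ kroneckerSym (4 * δ) n = -1 := by
  rcases Nat.even_or_odd n with hn | hn
  · exact Or.inl (kroneckerSym_even δ hn)
  · rw [kroneckerSym_odd δ hn]; exact jacobiSym.trichotomy δ n

/-- The Kronecker symbol `(4δ / ·)` as an arithmetic function. -/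
def kroneckerArith (δ : ℤ) : ArithmeticFunction ℤ := ⟨kroneckerSym (4 * δ), kroneckerSym_zero δ⟩

lemma kroneckerArith_apply (δ : ℤ) (n : ℕ) : kroneckerArith δ n = kroneckerSym (4 * δ) n := rfl

/-- The indicator function of the squarefree numbers. -/
def sqfreeArith : ArithmeticFunction ℤ :=
  ArithmeticFunction.moebius.pmul ArithmeticFunction.moebius

lemma sqfreeArith_apply (n : ℕ) : sqfreeArith n = if Squarefree n then 1 else 0 := by
  rw [sqfreeArith, ArithmeticFunction.pmul_apply, ← sq, ArithmeticFunction.moebius_sq]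

lemma isMultiplicative_kroneckerArith (δ : ℤ) : (kroneckerArith δ).IsMultiplicative :=
  ⟨kroneckerSym_one δ, fun _ => kroneckerSym_mul δ _ _⟩

lemma isMultiplicative_conv (δ : ℤ) : (sqfreeArith * kroneckerArith δ).IsMultiplicative :=
  (ArithmeticFunction.isMultiplicative_moebius.pmul
    ArithmeticFunction.isMultiplicative_moebius).mul (isMultiplicative_kroneckerArith δ)

/-- Only the divisors 1 and p of a power of p are squarefree, which leaves two terms. -/
lemma conv_prime_pow (δ : ℤ) {p k : ℕ} (hp : p.Prime) :
    (sqfreeArith * kroneckerArith δ) (p ^ (k + 1))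
      = kroneckerSym (4 * δ) p ^ (k + 1) + kroneckerSym (4 * δ) p ^ k := by
  rw [ArithmeticFunction.mul_apply, Nat.sum_divisorsAntidiagonal
    (fun x y => sqfreeArith x * kroneckerArith δ y), Nat.sum_divisors_prime_pow hp,
    Finset.sum_range_succ', Finset.sum_range_succ']
  have h0 : ∀ i ∈ Finset.range k, sqfreeArith (p ^ (i + 1 + 1)) *
      kroneckerArith δ (p ^ (k + 1) / p ^ (i + 1 + 1)) = 0 := by
    intro i _
    rw [sqfreeArith_apply, if_neg, zero_mul]
    intro h
    have := h p ⟨p ^ i, by ring⟩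
    exact hp.not_isUnit this
  rw [Finset.sum_eq_zero h0]
  simp only [zero_add, pow_zero, pow_one, Nat.div_one, sqfreeArith_apply, squarefree_one, if_true,
    hp.squarefree, one_mul, kroneckerArith_apply, kroneckerSym_pow]
  rw [pow_succ p k, Nat.mul_div_cancel _ hp.pos, kroneckerSym_pow, add_comm]

/-! ### Square roots of δ modulo d. -/

/-- The number of square roots of `δ` modulo `d`. -/
noncomputable def rootCount (δ : ℤ) (d : ℕ) : ℕ := Nat.card {x : ZMod d // x ^ 2 = (δ : ZMod d)}

/-- Chinese remainder theorem. -/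
lemma rootCount_mul (δ : ℤ) {a b : ℕ} (hab : a.Coprime b) :
    rootCount δ (a * b) = rootCount δ a * rootCount δ b := by
  unfold rootCount
  rw [← Nat.card_prod]
  refine Nat.card_congr ?_
  let e := ZMod.chineseRemainder hab
  refine (Equiv.subtypeEquiv e.toEquiv (q := fun y : ZMod a × ZMod b =>
    y.1 ^ 2 = (δ : ZMod a) ∧ y.2 ^ 2 = (δ : ZMod b)) ?_).trans ?_
  · intro x
    rw [← e.injective.eq_iff, map_pow, map_intCast, Prod.ext_iff]
    rfl
  · exact
      { toFun := fun y => (⟨y.1.1, y.2.1⟩, ⟨y.1.2, y.2.2⟩)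
        invFun := fun y => ⟨(y.1.1, y.2.1), ⟨y.1.2, y.2.2⟩⟩
        left_inv := fun _ => rfl
        right_inv := fun _ => rfl }

lemma rootCount_eq_zero (δ : ℤ) {d : ℕ} (h : ∀ y : ℤ, ¬ (d : ℤ) ∣ y ^ 2 - δ) :
    rootCount δ d = 0 := by
  unfold rootCount
  rw [Nat.card_eq_zero]
  left
  constructor
  rintro ⟨x, hx⟩
  obtain ⟨y, rfl⟩ := ZMod.intCast_surjective x
  apply h y
  rw [← ZMod.intCast_zmod_eq_zero_iff_dvd]
  push_cast
  rw [hx, sub_self]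

lemma rootCount_le_one (δ : ℤ) {d : ℕ}
    (h : ∀ y z : ℤ, (d : ℤ) ∣ y ^ 2 - δ → (d : ℤ) ∣ z ^ 2 - δ → (d : ℤ) ∣ y - z) :
    rootCount δ d ≤ 1 := by
  unfold rootCount
  have : Subsingleton {x : ZMod d // x ^ 2 = (δ : ZMod d)} := by
    constructor
    rintro ⟨x, hx⟩ ⟨x', hx'⟩
    obtain ⟨y, rfl⟩ := ZMod.intCast_surjective x
    obtain ⟨z, rfl⟩ := ZMod.intCast_surjective x'
    have := h y z (by rw [← ZMod.intCast_zmod_eq_zero_iff_dvd]; push_cast; rw [hx, sub_self])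
      (by rw [← ZMod.intCast_zmod_eq_zero_iff_dvd]; push_cast; rw [hx', sub_self])
    rw [← ZMod.intCast_zmod_eq_zero_iff_dvd] at this
    push_cast at this
    exact Subtype.ext (sub_eq_zero.1 this)
  exact Finite.card_le_one_iff_subsingleton.2 this

lemma rootCount_le_two (δ : ℤ) {d : ℕ}
    (h : ∀ y z : ℤ, (d : ℤ) ∣ y ^ 2 - δ → (d : ℤ) ∣ z ^ 2 - δ →
      (d : ℤ) ∣ y - z ∨ (d : ℤ) ∣ y + z) :
    rootCount δ d ≤ 2 := by
  unfold rootCount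
  by_cases hne : Nonempty {x : ZMod d // x ^ 2 = (δ : ZMod d)}
  · obtain ⟨⟨x₀, hx₀⟩⟩ := hne
    obtain ⟨y, rfl⟩ := ZMod.intCast_surjective x₀
    have hsub : {x : ZMod d | x ^ 2 = (δ : ZMod d)} ⊆ (({(y : ZMod d), -(y : ZMod d)} : Finset _) : Set (ZMod d)) := by
      intro x hx
      obtain ⟨z, rfl⟩ := ZMod.intCast_surjective x
      have := h y z (by rw [← ZMod.intCast_zmod_eq_zero_iff_dvd]; push_cast; rw [hx₀, sub_self])
        (by rw [← ZMod.intCast_zmod_eq_zero_iff_dvd]; push_cast; rw [hx, sub_self])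
      rw [← ZMod.intCast_zmod_eq_zero_iff_dvd, ← ZMod.intCast_zmod_eq_zero_iff_dvd] at this
      push_cast at this
      simp only [Finset.coe_insert, Finset.coe_singleton, Set.mem_insert_iff, Set.mem_singleton_iff]
      rcases this with h | h
      · left; exact (sub_eq_zero.1 h).symm
      · right; rw [← sub_eq_zero, sub_neg_eq_add, add_comm]; exact h
    have h1 := Nat.card_mono (Finset.finite_toSet _) hsub
    refine h1.trans ?_
    rw [Nat.card_eq_card_toFinset, Finset.toFinset_coe]
    exact Finset.card_le_two
  · have : IsEmpty {x : ZMod d // x ^ 2 = (δ : ZMod d)} := not_nonempty_iff.1 hne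
    simp

/-- At 2 the symbol vanishes, and δ, being neither 0 nor 1 modulo 4, has one root modulo 2 and none
modulo 4. An odd p ∣ δ allows one root modulo p and none modulo p², as δ is squarefree. If (δ/p) =
1, two roots y, z give p^(k+1) ∣ (y - z)(y + z) with p dividing at most one factor, so z = ±y. If
(δ/p) = -1 there is no root and the right-hand side cancels. -/
lemma rootCount_prime_pow_le {δ : ℤ} (hsq : Squarefree δ) (h4 : ¬ δ ≡ 1 [ZMOD 4]) {p k : ℕ}
    (hp : p.Prime) :
    (rootCount δ (p ^ (k + 1)) : ℤ) ≤ (sqfreeArith * kroneckerArith δ) (p ^ (k + 1)) := by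
  rw [conv_prime_pow δ hp]
  have hpk : ((p : ℤ)) ∣ ((p ^ (k + 1) : ℕ) : ℤ) := by push_cast; exact dvd_pow_self _ (by omega)
  have hpZ : Prime (p : ℤ) := Nat.prime_iff_prime_int.1 hp
  have hp2k : k ≠ 0 → ((p : ℤ)) ^ 2 ∣ ((p ^ (k + 1) : ℕ) : ℤ) := by
    intro hk; push_cast; exact pow_dvd_pow _ (by omega)
  by_cases hp2 : p = 2
  · subst hp2
    rw [kroneckerSym_even δ even_two, zero_pow (by omega), zero_add]
    rcases Nat.eq_zero_or_pos k with rfl | hk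
    · rw [pow_zero, zero_add, pow_one]
      have := rootCount_le_one δ (d := 2) ?_
      · exact_mod_cast this
      · intro y z hy hz
        have e1 : (y ^ 2 - y) % 2 = 0 := by
          have := Int.even_mul_pred_self y; rw [Int.even_iff] at this; rw [← this]; ring_nf
        have e2 : (z ^ 2 - z) % 2 = 0 := by
          have := Int.even_mul_pred_self z; rw [Int.even_iff] at this; rw [← this]; ring_nf
        push_cast at hy hz ⊢
        omega
    · rw [zero_pow (by omega), rootCount_eq_zero, Nat.cast_zero]
      intro y hy
      have h := (hp2k (by omega)).trans hy
      norm_num at h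
      apply h4
      have hδ2 : ¬ (4 : ℤ) ∣ δ := by
        intro h
        have := hsq 2 (by norm_num; exact h)
        rw [Int.isUnit_iff] at this; omega
      unfold Int.ModEq
      rcases Int.even_or_odd' y with ⟨m, rfl | rfl⟩
      · exfalso; apply hδ2
        have : (2 * m) ^ 2 - δ = 4 * (m ^ 2) - δ := by ring
        omega
      · have : (2 * m + 1) ^ 2 - δ = 4 * (m ^ 2 + m) + 1 - δ := by ring
        omega
  · have hodd : Odd p := hp.odd_of_ne_two hp2
    rw [kroneckerSym_odd δ hodd]
    have : Fact p.Prime := ⟨hp⟩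
    by_cases hpd : (p : ℤ) ∣ δ
    · have h0 : jacobiSym δ p = 0 := by
        rw [← jacobiSym.legendreSym.to_jacobiSym, legendreSym.eq_zero_iff]
        exact (ZMod.intCast_zmod_eq_zero_iff_dvd _ _).2 hpd
      rw [h0, zero_pow (by omega), zero_add]
      have hroot : ∀ y : ℤ, ((p ^ (k + 1) : ℕ) : ℤ) ∣ y ^ 2 - δ → (p : ℤ) ∣ y := by
        intro y hy
        have := (Int.dvd_add_right (hpd)).2 (hpk.trans hy)
        rw [add_sub_cancel] at this
        exact hpZ.dvd_of_dvd_pow this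
      rcases Nat.eq_zero_or_pos k with rfl | hk
      · rw [pow_zero]
        have := rootCount_le_one δ (d := p ^ (0 + 1)) ?_
        · exact_mod_cast this
        · intro y z hy hz
          have := dvd_sub (hroot y hy) (hroot z hz)
          simpa using this
      · rw [zero_pow (by omega), rootCount_eq_zero, Nat.cast_zero]
        intro y hy
        have h1 : (p : ℤ) ^ 2 ∣ y ^ 2 := pow_dvd_pow_of_dvd (hroot y hy) 2
        have h2 := (hp2k (by omega)).trans hy
        have h3 : (p : ℤ) ^ 2 ∣ δ := by
          have := dvd_sub h1 h2
          simpa using this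
        exact hpZ.not_isUnit (hsq p (by rw [← sq]; exact h3))
    · rcases jacobiSym.trichotomy δ p with h | h | h
      · exfalso
        rw [← jacobiSym.legendreSym.to_jacobiSym, legendreSym.eq_zero_iff] at h
        exact hpd ((ZMod.intCast_zmod_eq_zero_iff_dvd _ _).1 h)
      · rw [h, one_pow, one_pow]
        have := rootCount_le_two δ (d := p ^ (k + 1)) ?_
        · exact_mod_cast this
        intro y z hy hz
        have hyz : ((p : ℤ)) ^ (k + 1) ∣ (y - z) * (y + z) := by
          rw [show (y - z) * (y + z) = y ^ 2 - δ - (z ^ 2 - δ) by ring]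
          exact_mod_cast dvd_sub hy hz
        have hy0 : ¬ (p : ℤ) ∣ y := by
          intro hd
          have := dvd_sub (dvd_pow hd two_ne_zero) (hpk.trans hy)
          rw [sub_sub_cancel] at this
          exact hpd this
        push_cast
        have hcop : ¬ (p : ℤ) ∣ (y - z) ∨ ¬ (p : ℤ) ∣ (y + z) := by
          by_contra! hc
          have h2 := dvd_add hc.1 hc.2
          rw [show y - z + (y + z) = 2 * y by ring] at h2
          rcases hpZ.dvd_or_dvd h2 with h3 | h3
          · have := (Nat.prime_dvd_prime_iff_eq hp Nat.prime_two).1 (by exact_mod_cast h3)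
            exact hp2 this
          · exact hy0 h3
        rcases hcop with hc | hc
        · right
          exact (IsCoprime.pow_left ((hpZ.irreducible.coprime_iff_not_dvd).2 hc)).dvd_of_dvd_mul_left hyz
        · left
          exact (IsCoprime.pow_left ((hpZ.irreducible.coprime_iff_not_dvd).2 hc)).dvd_of_dvd_mul_right hyz
      · rw [rootCount_eq_zero, h, Nat.cast_zero]
        · have : (-1 : ℤ) ^ (k + 1) + (-1) ^ k = 0 := by ring
          rw [this]
        · intro y hy
          rw [← jacobiSym.legendreSym.to_jacobiSym, legendreSym.eq_neg_one_iff] at h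
          apply h
          refine ⟨(y : ZMod p), ?_⟩
          have := (ZMod.intCast_zmod_eq_zero_iff_dvd _ _).2 (hpk.trans hy)
          push_cast at this
          rw [← sq]; exact (sub_eq_zero.1 this).symm

theorem rootCount_le_conv {δ : ℤ} (hsq : Squarefree δ) (h4 : ¬ δ ≡ 1 [ZMOD 4]) {d : ℕ}
    (hd : 0 < d) : (rootCount δ d : ℤ) ≤ (sqfreeArith * kroneckerArith δ) d := by
  induction d using Nat.recOnPosPrimePosCoprime with
  | zero => omega
  | one =>
    rw [(isMultiplicative_conv δ).map_one]
    have := rootCount_le_one δ (d := 1) (fun y z _ _ => by simp)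
    exact_mod_cast this
  | prime_pow p n hp hn =>
    obtain ⟨k, rfl⟩ : ∃ k, n = k + 1 := ⟨n - 1, by omega⟩
    exact rootCount_prime_pow_le hsq h4 hp
  | coprime a b ha hb hab iha ihb =>
    rw [rootCount_mul δ hab, (isMultiplicative_conv δ).map_mul_of_coprime hab]
    push_cast
    have h1 := iha (by omega)
    exact mul_le_mul h1 (ihb (by omega)) (by positivity) (le_trans (by positivity) h1)

lemma card_modEq_le (N d : ℕ) (hd : 0 < d) (v : ℤ) :
    ((((Finset.Icc 1 N).filter fun n : ℕ => (n : ℤ) ≡ v [ZMOD d]).card : ℕ) : ℝ) ≤ N / d + 1 := by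
  have hdr : (0 : ℝ) < d := by exact_mod_cast hd
  have h1 : ((Finset.Icc 1 N).filter fun n : ℕ => (n : ℤ) ≡ v [ZMOD d]).card
      ≤ ((Finset.Ioc (0 : ℤ) N).filter fun n : ℤ => n ≡ v [ZMOD d]).card := by
    refine Finset.card_le_card_of_injOn (fun n : ℕ => (n : ℤ)) ?_ (fun a _ b _ h => Int.ofNat.inj h)
    intro n hn
    simp only [Finset.coe_filter, Finset.mem_Icc, Set.mem_ofPred_eq, Finset.mem_Ioc] at hn ⊢
    exact ⟨by omega, hn.2⟩
  have h2 := Int.Ioc_filter_modEq_card (0 : ℤ) N (r := d) (by exact_mod_cast hd) v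
  have h3 : (((Finset.Ioc (0 : ℤ) N).filter fun n : ℤ => n ≡ v [ZMOD d]).card : ℝ)
      = ((max (⌊((N : ℤ) - v : ℚ) / (d : ℤ)⌋ - ⌊((0 : ℤ) - v : ℚ) / (d : ℤ)⌋) 0 : ℤ) : ℝ) := by
    rw [← h2]; push_cast; rfl
  refine (Nat.cast_le.2 h1).trans ?_
  rw [h3]
  have key : ((max (⌊((N : ℤ) - v : ℚ) / (d : ℤ)⌋ - ⌊((0 : ℤ) - v : ℚ) / (d : ℤ)⌋) 0 : ℤ) : ℚ)
      ≤ N / d + 1 := by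
    push_cast
    rw [max_le_iff]
    refine ⟨?_, by positivity⟩
    have a1 := Int.floor_le (((N : ℚ) - v) / d)
    have a2 := Int.lt_floor_add_one ((0 - v : ℚ) / d)
    have : ((N : ℚ) - v) / d = N / d + (0 - v) / d := by ring
    linarith
  have := (Rat.cast_le (K := ℝ)).2 key
  push_cast at this ⊢
  exact this

/-- Completing the square sends n to the root n + b of δ modulo d; each root accounts for one
residue class of n. -/
lemma card_dvd_quad_le (b c : ℤ) (N d : ℕ) (hd : 0 < d) :
    ((((Finset.Icc 1 N).filter fun n : ℕ => (d : ℤ) ∣ quad b c n).card : ℕ) : ℝ)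
      ≤ (N / d + 1) * rootCount (disc b c) d := by
  have : NeZero d := ⟨hd.ne'⟩
  classical
  set S : Finset (ZMod d) := Finset.univ.filter fun x => x ^ 2 = ((disc b c : ℤ) : ZMod d) with hS
  have hcard : rootCount (disc b c) d = S.card := by
    rw [rootCount, Nat.card_eq_fintype_card, Fintype.card_subtype]
  have hmaps : ∀ n ∈ (Finset.Icc 1 N).filter (fun n : ℕ => (d : ℤ) ∣ quad b c n),
      (((n : ℤ) + b : ℤ) : ZMod d) ∈ S := by
    intro n hn
    rw [Finset.mem_filter] at hn
    rw [hS, Finset.mem_filter]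
    refine ⟨Finset.mem_univ _, ?_⟩
    rw [← sub_eq_zero, ← Int.cast_pow, ← Int.cast_sub, ZMod.intCast_zmod_eq_zero_iff_dvd]
    convert hn.2 using 1
    rw [disc, quad]; ring
  rw [Finset.card_eq_sum_card_fiberwise hmaps, hcard]
  push_cast
  calc _ ≤ ∑ x ∈ S, ((N : ℝ) / d + 1) := by
        refine Finset.sum_le_sum fun x _ => ?_
        obtain ⟨v, rfl⟩ := ZMod.intCast_surjective x
        refine le_trans ?_ (card_modEq_le N d hd (v - b))
        refine Nat.cast_le.2 (Finset.card_le_card ?_)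
        intro n hn
        rw [Finset.mem_filter, Finset.mem_filter] at hn
        rw [Finset.mem_filter]
        refine ⟨hn.1.1, ?_⟩
        have := (ZMod.intCast_eq_intCast_iff ((n : ℤ) + b) v d).1 (by push_cast; exact hn.2)
        have := this.sub_right b
        simpa using this
    _ = _ := by rw [Finset.sum_const, nsmul_eq_mul, mul_comm]

/-! ### The character (4δ/·) modulo 4|δ|: periodicity, primitivity, Gauss sum. -/

lemma kroneckerSym_mod (δ : ℤ) (n : ℕ) :
    kroneckerSym (4 * δ) (n % (4 * δ.natAbs)) = kroneckerSym (4 * δ) n := by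
  have hpar : n % (4 * δ.natAbs) % 2 = n % 2 := Nat.mod_mod_of_dvd n ⟨2 * δ.natAbs, by ring⟩
  rcases Nat.even_or_odd n with hn | hn
  · rw [kroneckerSym_even δ hn, kroneckerSym_even]
    rw [Nat.even_iff] at hn ⊢; omega
  · rw [kroneckerSym_odd δ hn, kroneckerSym_odd, ← jacobiSym.mod_right δ hn]
    rw [Nat.odd_iff] at hn ⊢; omega

lemma coprime_of_kroneckerSym_ne_zero {δ : ℤ} {n : ℕ} (h : kroneckerSym (4 * δ) n ≠ 0) :
    n.Coprime (4 * δ.natAbs) := by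
  have hn : Odd n := by
    by_contra hc
    exact h (kroneckerSym_even δ (Nat.not_odd_iff_even.1 hc))
  rw [kroneckerSym_odd δ hn] at h
  have hne : NeZero n := ⟨hn.pos.ne'⟩
  have h1 : δ.gcd n = 1 := by
    by_contra hc
    exact h (jacobiSym.eq_zero_iff_not_coprime.2 hc)
  refine Nat.Coprime.mul_right ?_ ?_
  · exact (Nat.Coprime.pow_right 2 (Nat.coprime_two_right.2 hn) : Nat.Coprime n (2 ^ 2))
  · rw [Nat.coprime_comm]
    simpa [Int.gcd] using h1

/-- The Kronecker symbol `(4δ / ·)` as a Dirichlet character modulo `4|δ|`. -/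
noncomputable def kroneckerChar (δ : ℤ) (hδ : δ ≠ 0) : DirichletCharacter ℂ (4 * δ.natAbs) where
  toFun x := (kroneckerSym (4 * δ) x.val : ℂ)
  map_one' := by
    have h : 1 < 4 * δ.natAbs := by have := Int.natAbs_pos.2 hδ; omega
    have : Fact (1 < 4 * δ.natAbs) := ⟨h⟩
    rw [ZMod.val_one, kroneckerSym_one, Int.cast_one]
  map_mul' x y := by
    rw [ZMod.val_mul, kroneckerSym_mod, kroneckerSym_mul, Int.cast_mul]
  map_nonunit' x hx := by
    have : NeZero (4 * δ.natAbs) := ⟨by have := Int.natAbs_pos.2 hδ; omega⟩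
    by_contra hc
    apply hx
    have h := coprime_of_kroneckerSym_ne_zero (δ := δ) (n := x.val) (fun h0 => hc (by simp [h0]))
    rw [← ZMod.isUnit_iff_coprime, ZMod.natCast_zmod_val] at h
    exact h

lemma kroneckerChar_apply (δ : ℤ) (hδ : δ ≠ 0) (x : ZMod (4 * δ.natAbs)) :
    kroneckerChar δ hδ x = (kroneckerSym (4 * δ) x.val : ℂ) := rfl

lemma kroneckerChar_natCast (δ : ℤ) (hδ : δ ≠ 0) (n : ℕ) :
    kroneckerChar δ hδ (n : ZMod (4 * δ.natAbs)) = (kroneckerSym (4 * δ) n : ℂ) := by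
  rw [kroneckerChar_apply, ZMod.val_natCast, kroneckerSym_mod]

lemma jacobiSym_one_mod {a : ℤ} {n : ℕ} (hn : n % (4 * a.natAbs) = 1 % (4 * a.natAbs))
    (hodd : Odd n) : jacobiSym a n = 1 := by
  rw [jacobiSym.mod_right a hodd, hn, ← jacobiSym.mod_right a odd_one, jacobiSym.one_right]

lemma jacobiSym_one_add_self {D m : ℕ} : jacobiSym (((1 + m * D : ℕ) : ℤ)) D = 1 := by
  rw [jacobiSym.mod_left' (a₂ := 1), jacobiSym.one_left]
  push_cast
  simp

/-- At the prime `2`, the character `(4δ / ·)` is not defined modulo `2|δ|`. -/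
lemma kroneckerSym_one_add_two_mul {δ : ℤ} (hsq : Squarefree δ)
    (h4 : ¬ δ ≡ 1 [ZMOD 4]) : kroneckerSym (4 * δ) (1 + 2 * δ.natAbs) = -1 := by
  obtain ⟨D, hD⟩ : ∃ D, D = δ.natAbs := ⟨_, rfl⟩
  rw [← hD]
  have hodd : Odd (1 + 2 * D) := ⟨D, by ring⟩
  rw [kroneckerSym_odd δ hodd]
  have hδ4 : ¬ (4 : ℤ) ∣ δ := by
    intro h
    have := hsq 2 (by norm_num; exact h)
    rw [Int.isUnit_iff] at this; omega
  have hD0 : D ≠ 0 := by omega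
  unfold Int.ModEq at h4
  have hsign : δ = (D : ℤ) ∨ δ = -(D : ℤ) := by omega
  -- If D = 2E, then E is odd and 1 + 2D = 1 + 4E is 5 modulo 8: the factor 2 contributes -1,
  -- reciprocity makes the factor E contribute 1, and the sign of δ is invisible. If D is odd, δ is
  -- 3 modulo 4, and the -1 comes from reciprocity or from the symbol of -1.
  rcases Nat.even_or_odd' D with ⟨E, hE | hE⟩
  · have hEodd : Odd E := by rw [Nat.odd_iff]; omega
    have h1 : (1 + 2 * D) % 8 = 5 := by have := Nat.odd_iff.1 hEodd; omega
    have hDval : jacobiSym (D : ℤ) (1 + 2 * D) = -1 := by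
      rw [hE, Nat.cast_mul, jacobiSym.mul_left]
      rw [jacobiSym.quadratic_reciprocity_one_mod_four' hEodd (by omega),
        show 1 + 2 * (2 * E) = 1 + 4 * E by ring, jacobiSym_one_add_self]
      push_cast
      rw [jacobiSym.at_two (by rw [Nat.odd_iff]; omega), ZMod.χ₈_nat_eq_if_mod_eight]
      have : (1 + 4 * E) % 8 = 5 := by omega
      simp only [this]
      have : (1 + 4 * E) % 2 ≠ 0 := by omega
      simp [this]
    rcases hsign with h | h
    · rw [h]; exact hDval
    · rw [h, jacobiSym.neg _ hodd, hDval, ZMod.χ₄_nat_one_mod_four (by omega)]; norm_num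
  · have hDodd : Odd D := ⟨E, hE⟩
    rcases hsign with h | h
    · rw [h, jacobiSym.quadratic_reciprocity_three_mod_four (by omega) (by omega),
        jacobiSym_one_add_self]
    · rw [h, jacobiSym.neg _ hodd,
        jacobiSym.quadratic_reciprocity_one_mod_four (by omega) hodd,
        jacobiSym_one_add_self, ZMod.χ₄_nat_three_mod_four (by omega)]; norm_num

/-- This prevents the conductor from dropping by the factor p. For odd p write δ = pε and choose u
congruent to 1 modulo 4|ε| and a non-residue modulo p; as u is 1 modulo 4, reciprocity gives (δ/u) =
(u/p) = -1. -/
lemma exists_kroneckerSym_neg_one {δ : ℤ} (hsq : Squarefree δ)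
    (h4 : ¬ δ ≡ 1 [ZMOD 4]) {p m : ℕ} (hp : p.Prime) (hpm : 4 * δ.natAbs = p * m) :
    ∃ u : ℕ, u ≡ 1 [MOD m] ∧ kroneckerSym (4 * δ) u = -1 := by
  by_cases hp2 : p = 2
  · subst hp2
    refine ⟨1 + 2 * δ.natAbs, ?_, kroneckerSym_one_add_two_mul hsq h4⟩
    have : m = 2 * δ.natAbs := by omega
    rw [this]
    unfold Nat.ModEq
    simp
  · have hpD : p ∣ δ.natAbs := by
      have h1 : p ∣ 4 * δ.natAbs := ⟨m, hpm⟩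
      rcases hp.dvd_mul.1 h1 with h | h
      · have : p ∣ 2 := hp.dvd_of_dvd_pow (show p ∣ 2 ^ 2 from h)
        exact absurd ((Nat.prime_dvd_prime_iff_eq hp Nat.prime_two).1 this) hp2
      · exact h
    obtain ⟨ε, hε⟩ := Int.natCast_dvd.2 hpD
    have hεp : ¬ p ∣ ε.natAbs := by
      intro h
      obtain ⟨η, rfl⟩ := Int.natCast_dvd.2 h
      have := hsq p ⟨η, by rw [hε]; ring⟩
      exact (Nat.prime_iff_prime_int.1 hp).not_isUnit this
    have hm : m = 4 * ε.natAbs := by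
      have : 4 * δ.natAbs = p * (4 * ε.natAbs) := by
        rw [hε, Int.natAbs_mul, Int.natAbs_natCast]; ring
      exact Nat.eq_of_mul_eq_mul_left hp.pos (hpm.symm.trans this)
    have : Fact p.Prime := ⟨hp⟩
    obtain ⟨r, hr⟩ := FiniteField.exists_nonsquare (F := ZMod p) (by rw [ZMod.ringChar_zmod_n]; exact hp2)
    have hcop : Nat.Coprime m p := by
      rw [hm, Nat.coprime_comm, hp.coprime_iff_not_dvd, hp.dvd_mul]
      rintro (h | h)
      · have : p ∣ 2 := hp.dvd_of_dvd_pow (show p ∣ 2 ^ 2 from h)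
        exact absurd ((Nat.prime_dvd_prime_iff_eq hp Nat.prime_two).1 this) hp2
      · exact hεp h
    obtain ⟨u, hu1, hu2⟩ := Nat.chineseRemainder hcop 1 r.val
    refine ⟨u, hu1, ?_⟩
    have hu4 : u % 4 = 1 := by
      have : u ≡ 1 [MOD 4] := hu1.of_dvd ⟨ε.natAbs, hm⟩
      exact this
    have huodd : Odd u := by rw [Nat.odd_iff]; omega
    rw [kroneckerSym_odd δ huodd, hε, jacobiSym.mul_left,
      jacobiSym_one_mod (a := ε) (by rw [← hm]; exact hu1) huodd, mul_one,
      jacobiSym.quadratic_reciprocity_one_mod_four' (hp.odd_of_ne_two hp2) hu4,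
      ← jacobiSym.legendreSym.to_jacobiSym, legendreSym.eq_neg_one_iff]
    have : ((u : ℤ) : ZMod p) = r := by
      have h := (ZMod.natCast_eq_natCast_iff _ _ _).2 hu2
      rw [ZMod.natCast_zmod_val] at h
      exact_mod_cast h
    rw [this]
    exact hr

/-- A conductor smaller than 4|δ| would divide 4|δ|/p for some prime p, and then χ(u) = 1 for the u
with u ≡ 1 modulo 4|δ|/p and χ(u) = -1 found above. -/
theorem kroneckerChar_isPrimitive {δ : ℤ} (hδ : δ ≠ 0) (hsq : Squarefree δ)
    (h4 : ¬ δ ≡ 1 [ZMOD 4]) : (kroneckerChar δ hδ).IsPrimitive := by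
  have hne : NeZero (4 * δ.natAbs) := ⟨by have := Int.natAbs_pos.2 hδ; omega⟩
  rw [DirichletCharacter.isPrimitive_def]
  by_contra hc
  set χ := kroneckerChar δ hδ with hχ
  obtain ⟨e, he⟩ := DirichletCharacter.conductor_dvd_level χ
  have he1 : e ≠ 1 := by
    rintro rfl; exact hc (by rw [mul_one] at he; exact he.symm)
  obtain ⟨p, hp, f, hf⟩ := Nat.exists_prime_and_dvd he1
  obtain ⟨u, hu1, hu2⟩ := exists_kroneckerSym_neg_one hsq h4 (m := χ.conductor * f) hp
    (he.trans (by rw [hf]; ring))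
  have hcop : u.Coprime (4 * δ.natAbs) :=
    coprime_of_kroneckerSym_ne_zero (δ := δ) (by rw [hu2]; norm_num)
  have hval : χ (u : ZMod (4 * δ.natAbs)) = -1 := by
    rw [hχ, kroneckerChar_natCast, hu2]; norm_num
  have hfac := DirichletCharacter.factorsThrough_conductor χ
  have hone : χ (u : ZMod (4 * δ.natAbs)) = 1 := by
    rw [hfac.eq_changeLevel]
    have h1 := DirichletCharacter.changeLevel_eq_cast_of_dvd hfac.χ₀ hfac.dvd
      (ZMod.unitOfCoprime u hcop)
    rw [ZMod.coe_unitOfCoprime] at h1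
    rw [h1, ZMod.cast_natCast hfac.dvd]
    have : ((u : ℕ) : ZMod χ.conductor) = ((1 : ℕ) : ZMod χ.conductor) :=
      (ZMod.natCast_eq_natCast_iff _ _ _).2 (hu1.of_dvd (dvd_mul_right _ _))
    rw [this, Nat.cast_one, map_one]
  rw [hone] at hval
  norm_num at hval

open scoped ZMod in
/-- Finite Fourier expansion of the Kronecker symbol, the Gauss sum having modulus `√(4|δ|)`. -/
theorem exists_gaussSum_expansion {δ : ℤ} (hδ : δ ≠ 0) (hsq : Squarefree δ)
    (h4 : ¬ δ ≡ 1 [ZMOD 4]) [NeZero (4 * δ.natAbs)] :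
    ∃ C : ℂ, ‖C‖ = √(4 * δ.natAbs : ℝ) ∧ ∀ x : ZMod (4 * δ.natAbs),
      C * kroneckerChar δ hδ x = ∑ j : ZMod (4 * δ.natAbs),
        ZMod.stdAddChar (-(j * x)) * kroneckerChar δ hδ j := by
  set χ := kroneckerChar δ hδ with hχ
  have hreal : ∀ x, χ x = 0 ∨ χ x = 1 ∨ χ x = -1 := by
    intro x
    rw [hχ, kroneckerChar_apply]
    rcases kroneckerSym_trichotomy δ x.val with h | h | h <;> rw [h] <;> simp
  have hinv : ∀ x, χ⁻¹ x = χ x := by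
    intro x
    rw [MulChar.inv_apply_eq_inv]
    rcases hreal x with h | h | h <;> rw [h] <;> simp
  have hF : ∀ k, 𝓕 χ k = (χ (-1) * gaussSum χ ZMod.stdAddChar) * χ k := by
    intro k
    rw [DirichletCharacter.IsPrimitive.fourierTransform_eq_inv_mul_gaussSum
      (kroneckerChar_isPrimitive hδ hsq h4) k, ← hχ, hinv, ← neg_one_mul k, map_mul]
    ring
  set C := χ (-1) * gaussSum χ ZMod.stdAddChar with hC
  -- Transforming twice multiplies by the modulus and reflects, so C² = 4|δ| χ(-1); this gives the
  -- modulus of C without evaluating the Gauss sum.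
  have hFF := congrFun (ZMod.dft_dft (χ : ZMod (4 * δ.natAbs) → ℂ)) 1
  have hFfun : 𝓕 (χ : ZMod (4 * δ.natAbs) → ℂ) = fun k => C * χ k := funext hF
  rw [hFfun, ZMod.dft_const_mul, hFfun] at hFF
  simp only [map_one, mul_one, smul_eq_mul] at hFF
  refine ⟨C, ?_, fun x => ?_⟩
  · have h1 : ‖χ (-1)‖ = 1 := by
      have hu : χ (-1) ≠ 0 := by
        intro h0
        have : χ (-1) * χ (-1) = 1 := by rw [← map_mul]; simp
        rw [h0] at this; simp at this
      rcases hreal (-1) with h | h | h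
      · exact absurd h hu
      · rw [h]; simp
      · rw [h]; simp
    have h2 := congrArg norm hFF
    rw [norm_mul C, norm_mul _ (χ (-1)), h1, mul_one] at h2
    rw [← Real.sqrt_mul_self (norm_nonneg C), h2]
    simp
  · rw [← hF x, ZMod.dft_apply]
    simp only [smul_eq_mul]

/-! ### Pólya–Vinogradov by averaging over shifted windows. -/

lemma sum_range_odd {M : Type*} [AddCommMonoid M] (f : ℕ → M) (n : ℕ) :
    ∑ v ∈ Finset.range (2 * n), (if Odd v then f v else 0)
      = ∑ i ∈ Finset.range n, f (2 * i + 1) := by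
  induction n with
  | zero => simp
  | succ n ih =>
    rw [show 2 * (n + 1) = 2 * n + 1 + 1 by ring, Finset.sum_range_succ, Finset.sum_range_succ, ih,
      Finset.sum_range_succ, if_neg (by simp), if_pos ⟨n, rfl⟩, add_zero]

/-- For odd D the rounded-up half contains the middle term, which is then counted twice; hence an
inequality. -/
lemma sum_range_half_le {f : ℕ → ℝ} {D : ℕ} (hf : ∀ i, 0 ≤ f i)
    (hsymm : ∀ i < D, f (D - 1 - i) = f i) :
    ∑ i ∈ Finset.range D, f i ≤ 2 * ∑ i ∈ Finset.range ((D + 1) / 2), f i := by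
  obtain ⟨E, hE⟩ : ∃ E, E = (D + 1) / 2 := ⟨_, rfl⟩
  obtain ⟨F, hF⟩ : ∃ F, D = E + F := ⟨D - E, by omega⟩
  rw [← hE]
  have h1 : ∑ i ∈ Finset.range D, f i
      = ∑ i ∈ Finset.range E, f i + ∑ k ∈ Finset.range F, f (E + k) := by
    rw [hF, Finset.sum_range_add]
  have h2 : ∑ k ∈ Finset.range F, f (E + k) = ∑ k ∈ Finset.range F, f k := by
    rw [← Finset.sum_range_reflect (fun k => f k) F]
    refine Finset.sum_congr rfl fun k hk => ?_
    rw [Finset.mem_range] at hk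
    rw [← hsymm (E + k) (by omega)]
    congr 1; omega
  have h3 : ∑ k ∈ Finset.range F, f k ≤ ∑ k ∈ Finset.range E, f k :=
    Finset.sum_le_sum_of_subset_of_nonneg (Finset.range_mono (by omega)) (fun i _ _ => hf i)
  linarith

/-- The root of unity `exp (-π i v / D)`. -/
noncomputable def unitRoot (D v : ℕ) : ℂ := Complex.exp (Complex.I * ((-(Real.pi * v / D) : ℝ) : ℂ))

/-- Product of the moduli of two geometric sums in `unitRoot D v`. -/
noncomputable def geomProd (D H L v : ℕ) : ℝ :=
  ‖∑ i ∈ Finset.range H, unitRoot D v ^ i‖ * ‖∑ i ∈ Finset.range L, unitRoot D v ^ i‖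

lemma geomProd_nonneg (D H L v : ℕ) : 0 ≤ geomProd D H L v := by unfold geomProd; positivity

lemma unitRoot_add {D : ℕ} (hD : 0 < D) (v : ℕ) : unitRoot D (v + 2 * D) = unitRoot D v := by
  have hD' : (D : ℂ) ≠ 0 := by exact_mod_cast hD.ne'
  unfold unitRoot
  rw [Complex.exp_eq_exp_iff_exists_int]
  refine ⟨-1, ?_⟩
  push_cast
  field_simp
  ring

lemma unitRoot_sub {D : ℕ} (hD : 0 < D) {v : ℕ} (hv : v ≤ 2 * D) :
    unitRoot D (2 * D - v) = (starRingEnd ℂ) (unitRoot D v) := by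
  have hD' : (D : ℂ) ≠ 0 := by exact_mod_cast hD.ne'
  unfold unitRoot
  rw [← Complex.exp_conj, Complex.exp_eq_exp_iff_exists_int]
  refine ⟨-1, ?_⟩
  rw [map_mul, Complex.conj_I, Complex.conj_ofReal]
  push_cast [Nat.cast_sub hv]
  field_simp
  ring

lemma geomProd_add {D : ℕ} (hD : 0 < D) (H L v : ℕ) :
    geomProd D H L (v + 2 * D) = geomProd D H L v := by
  unfold geomProd; rw [unitRoot_add hD]

lemma geomProd_sub {D : ℕ} (hD : 0 < D) (H L : ℕ) {v : ℕ} (hv : v ≤ 2 * D) :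
    geomProd D H L (2 * D - v) = geomProd D H L v := by
  unfold geomProd
  rw [unitRoot_sub hD hv]
  simp only [← map_pow, ← map_sum, Complex.norm_conj]

lemma norm_unitRoot (D v : ℕ) : ‖unitRoot D v‖ = 1 := by
  unfold unitRoot
  rw [mul_comm]
  exact Complex.norm_exp_ofReal_mul_I _

/-- The closed form of the geometric sum, with |ω - 1| = 2 sin(πv/(2D)) and |ω^n - 1| ≤ 2. -/
lemma norm_geom_sum_le {D v : ℕ} (n : ℕ) (hs : 0 < Real.sin (Real.pi * v / (2 * D))) :
    ‖∑ i ∈ Finset.range n, unitRoot D v ^ i‖ ≤ 1 / Real.sin (Real.pi * v / (2 * D)) := by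
  have h1 : ‖unitRoot D v - 1‖ = 2 * Real.sin (Real.pi * v / (2 * D)) := by
    unfold unitRoot
    rw [Complex.norm_exp_I_mul_ofReal_sub_one, neg_div, Real.sin_neg, mul_neg, norm_neg,
      Real.norm_eq_abs, div_div, mul_comm (D : ℝ) 2]
    exact abs_of_pos (by positivity)
  have h2 := geom_sum_mul (unitRoot D v) n
  have h3 := congrArg norm h2
  rw [norm_mul, h1] at h3
  have h4 : ‖unitRoot D v ^ n - 1‖ ≤ 2 := by
    refine (norm_sub_le _ _).trans ?_
    rw [norm_pow, norm_unitRoot, one_pow, norm_one]; norm_num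
  rw [le_div_iff₀ hs]
  nlinarith

lemma norm_geom_sum_le_card {D v : ℕ} (n : ℕ) :
    ‖∑ i ∈ Finset.range n, unitRoot D v ^ i‖ ≤ n := by
  refine (norm_sum_le _ _).trans ?_
  simp [norm_unitRoot]

/-- Periodicity and conjugation fold the odd frequencies onto the first half of [0, D], whence the
factor 4. Below the cut-off B one geometric sum is bounded by its length H and the other by 1/sin;
above it both are bounded by 1/sin. -/
lemma sum_geomProd_le {D : ℕ} (hD : 0 < D) (H L B : ℕ) (hB : 2 * B ≤ D + 1) :
    ∑ i ∈ Finset.range (2 * D), geomProd D H L (2 * i + 1)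
      ≤ 4 * (H * ∑ i ∈ Finset.range B, 1 / Real.sin (Real.pi * (2 * i + 1) / (2 * D))
        + ∑ i ∈ Finset.Ico B ((D + 1) / 2),
          1 / Real.sin (Real.pi * (2 * i + 1) / (2 * D)) ^ 2) := by
  have hDr : (0 : ℝ) < D := by exact_mod_cast hD
  set f : ℕ → ℝ := fun i => geomProd D H L (2 * i + 1) with hf
  have h1 : ∑ i ∈ Finset.range (2 * D), f i = 2 * ∑ i ∈ Finset.range D, f i := by
    rw [two_mul, Finset.sum_range_add, two_mul]
    congr 1
    refine Finset.sum_congr rfl fun i _ => ?_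
    rw [hf]
    simp only
    rw [show 2 * (D + i) + 1 = 2 * i + 1 + 2 * D by ring, geomProd_add hD]
  have h2 := sum_range_half_le (f := f) (D := D) (fun i => geomProd_nonneg _ _ _ _) (by
    intro i hi
    rw [hf]
    simp only
    rw [← geomProd_sub hD H L (show 2 * i + 1 ≤ 2 * D by omega)]
    congr 1; omega)
  have hsin : ∀ i < (D + 1) / 2, 0 < Real.sin (Real.pi * ((2 * i + 1 : ℕ) : ℝ) / (2 * D)) := by
    intro i hi
    apply Real.sin_pos_of_pos_of_lt_pi
    · positivity
    · rw [div_lt_iff₀ (by positivity)]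
      have : ((2 * i + 1 : ℕ) : ℝ) < 2 * D := by exact_mod_cast (by omega : 2 * i + 1 < 2 * D)
      exact mul_lt_mul_of_pos_left this Real.pi_pos
  have h3 : ∑ i ∈ Finset.range ((D + 1) / 2), f i
      ≤ H * ∑ i ∈ Finset.range B, 1 / Real.sin (Real.pi * (2 * i + 1) / (2 * D))
        + ∑ i ∈ Finset.Ico B ((D + 1) / 2),
          1 / Real.sin (Real.pi * (2 * i + 1) / (2 * D)) ^ 2 := by
    rw [← Finset.sum_range_add_sum_Ico _ (show B ≤ (D + 1) / 2 by omega), Finset.mul_sum]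
    refine add_le_add (Finset.sum_le_sum fun i hi => ?_) (Finset.sum_le_sum fun i hi => ?_)
    · rw [Finset.mem_range] at hi
      have hs := hsin i (by omega)
      have a1 := norm_geom_sum_le L hs
      have a2 := norm_geom_sum_le_card (D := D) (v := 2 * i + 1) H
      push_cast at a1
      exact mul_le_mul a2 a1 (norm_nonneg _) (by positivity)
    · rw [Finset.mem_Ico] at hi
      have hs := hsin i (by omega)
      have a1 := norm_geom_sum_le L hs
      have a2 := norm_geom_sum_le H hs
      push_cast at a1 a2
      have := mul_le_mul a2 a1 (norm_nonneg _) (le_trans (norm_nonneg _) a2)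
      refine this.trans (le_of_eq ?_)
      rw [← sq, div_pow, one_pow]
  linarith

lemma sum_zmod_eq_sum_range {M : Type*} [AddCommMonoid M] (q : ℕ) [NeZero q] (f : ZMod q → M) :
    ∑ x : ZMod q, f x = ∑ v ∈ Finset.range q, f (v : ZMod q) := by
  refine Finset.sum_bij' (fun x _ => x.val) (fun v _ => (v : ZMod q)) ?_ ?_ ?_ ?_ ?_
  · intro x _; exact Finset.mem_range.2 (ZMod.val_lt x)
  · intro v _; exact Finset.mem_univ _
  · intro x _; exact ZMod.natCast_zmod_val x
  · intro v hv; exact ZMod.val_cast_of_lt (Finset.mem_range.1 hv)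
  · intro x _; rw [ZMod.natCast_zmod_val]

lemma norm_stdAddChar {q : ℕ} [NeZero q] (x : ZMod q) : ‖ZMod.stdAddChar x‖ = 1 := by
  rw [ZMod.stdAddChar_apply]; exact Circle.norm_coe _

lemma stdAddChar_neg_two_mul {D : ℕ} (v : ℕ) [NeZero (4 * D)] :
    ZMod.stdAddChar (-(2 * (v : ZMod (4 * D)))) = unitRoot D v := by
  have h : (-(2 * (v : ZMod (4 * D)))) = ((-(2 * (v : ℤ)) : ℤ) : ZMod (4 * D)) := by push_cast; rfl
  have hD : (D : ℂ) ≠ 0 := by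
    have := NeZero.ne (4 * D)
    exact_mod_cast (by omega : D ≠ 0)
  rw [h, ZMod.stdAddChar_coe, unitRoot]
  congr 1
  push_cast
  field_simp
  ring

/-- The sum of `χ` over `L` consecutive odd residues, starting at `2 j + 1`. -/
noncomputable def oddWindow (δ : ℤ) (hδ : δ ≠ 0) (L : ℕ) (j : ℤ) : ℂ :=
  ∑ m ∈ Finset.range L, kroneckerChar δ hδ (((2 * (j + m) + 1 : ℤ) : ZMod (4 * δ.natAbs)))

lemma norm_kroneckerChar_le (δ : ℤ) (hδ : δ ≠ 0) (x : ZMod (4 * δ.natAbs)) :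
    ‖kroneckerChar δ hδ x‖ ≤ 1 := by
  rw [kroneckerChar_apply]
  rcases kroneckerSym_trichotomy δ x.val with h | h | h <;> rw [h] <;> simp

/-- Shifting the window by one step drops one term and gains one. -/
lemma norm_oddWindow_succ_sub (δ : ℤ) (hδ : δ ≠ 0) (L : ℕ) (j : ℤ) :
    ‖oddWindow δ hδ L (j + 1) - oddWindow δ hδ L j‖ ≤ 2 := by
  set g : ℕ → ℂ := fun m => kroneckerChar δ hδ (((2 * (j + m) + 1 : ℤ) : ZMod (4 * δ.natAbs)))
    with hg
  have h1 : oddWindow δ hδ L j = ∑ m ∈ Finset.range L, g m := rfl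
  have h2 : oddWindow δ hδ L (j + 1) = ∑ m ∈ Finset.range L, g (m + 1) := by
    refine Finset.sum_congr rfl fun m _ => ?_
    rw [hg]
    simp only
    congr 2
    push_cast; ring
  have h3 : oddWindow δ hδ L (j + 1) - oddWindow δ hδ L j = g L - g 0 := by
    rw [h1, h2, ← Finset.sum_sub_distrib, Finset.sum_range_sub]
  rw [h3]
  refine (norm_sub_le _ _).trans ?_
  have a := norm_kroneckerChar_le δ hδ (((2 * (j + L) + 1 : ℤ) : ZMod (4 * δ.natAbs)))
  have b := norm_kroneckerChar_le δ hδ (((2 * (j + (0 : ℕ)) + 1 : ℤ) : ZMod (4 * δ.natAbs)))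
  calc _ ≤ (1 : ℝ) + 1 := add_le_add a b
    _ = 2 := by norm_num

lemma norm_oddWindow_sub_le (δ : ℤ) (hδ : δ ≠ 0) (L : ℕ) (j : ℤ) (n : ℕ) :
    ‖oddWindow δ hδ L (j + n) - oddWindow δ hδ L j‖ ≤ 2 * n := by
  induction n with
  | zero => simp
  | succ n ih =>
    have h := norm_oddWindow_succ_sub δ hδ L (j + n)
    have e : oddWindow δ hδ L (j + (n + 1 : ℕ)) - oddWindow δ hδ L j
        = (oddWindow δ hδ L (j + n + 1) - oddWindow δ hδ L (j + n))
          + (oddWindow δ hδ L (j + n) - oddWindow δ hδ L j) := by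
      rw [show j + ((n + 1 : ℕ) : ℤ) = j + n + 1 by push_cast; ring]; ring
    rw [e]
    refine (norm_add_le _ _).trans ?_
    push_cast
    linarith

lemma sum_abs_sub (h : ℕ) :
    ∑ i ∈ Finset.range (2 * h + 1), |((i : ℤ) - h : ℤ)| = h * (h + 1) := by
  rw [show 2 * h + 1 = h + (h + 1) by ring, Finset.sum_range_add]
  have h1 : ∑ i ∈ Finset.range (h + 1), |(((h + i : ℕ) : ℤ) - h : ℤ)|
      = ∑ i ∈ Finset.range (h + 1), (i : ℤ) := by
    refine Finset.sum_congr rfl fun i _ => ?_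
    rw [abs_of_nonneg] <;> push_cast <;> linarith [Int.natCast_nonneg i]
  have h2 : ∑ i ∈ Finset.range h, |((i : ℤ) - h : ℤ)| = ∑ i ∈ Finset.range h, ((i : ℤ) + 1) := by
    rw [← Finset.sum_range_reflect (fun i => ((i : ℤ) + 1)) h]
    refine Finset.sum_congr rfl fun i hi => ?_
    rw [Finset.mem_range] at hi
    rw [abs_of_nonpos (by omega)]
    omega
  rw [h1, h2, Finset.sum_add_distrib, Finset.sum_range_succ]
  have h3 : ∀ n : ℕ, 2 * ∑ i ∈ Finset.range n, (i : ℤ) = n * (n - 1) := by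
    intro n
    induction n with
    | zero => simp
    | succ n ih => rw [Finset.sum_range_succ, mul_add, ih]; push_cast; ring
  have := h3 h
  simp only [Finset.sum_const, Finset.card_range, nsmul_eq_mul, mul_one]
  linarith

/-- A shift by k costs at most 2|k|, and over |k| ≤ h these costs add up to 2h(h + 1) ≤ (2h + 1)²/2.
-/
lemma norm_oddWindow_le_average (δ : ℤ) (hδ : δ ≠ 0) (L h : ℕ) :
    (2 * h + 1 : ℝ) * ‖oddWindow δ hδ L 0‖
      ≤ ‖∑ i ∈ Finset.range (2 * h + 1), oddWindow δ hδ L ((i : ℤ) - h)‖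
        + (2 * h + 1 : ℝ) ^ 2 / 2 := by
  have h1 : ∀ i : ℕ, ‖oddWindow δ hδ L 0 - oddWindow δ hδ L ((i : ℤ) - h)‖
      ≤ 2 * ((|((i : ℤ) - h : ℤ)| : ℤ) : ℝ) := by
    intro i
    rcases le_total h i with hi | hi
    · obtain ⟨k, rfl⟩ := Nat.exists_eq_add_of_le hi
      have := norm_oddWindow_sub_le δ hδ L 0 k
      rw [norm_sub_rev]
      have e : ((h + k : ℕ) : ℤ) - h = 0 + k := by push_cast; ring
      rw [e]
      simpa using this
    · obtain ⟨k, rfl⟩ := Nat.exists_eq_add_of_le hi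
      have := norm_oddWindow_sub_le δ hδ L (-k) k
      have e : (i : ℤ) - ((i + k : ℕ) : ℤ) = -k := by push_cast; ring
      rw [e]
      simpa using this
  have h2 : ((2 * h + 1 : ℕ) : ℂ) * oddWindow δ hδ L 0
      = ∑ i ∈ Finset.range (2 * h + 1), oddWindow δ hδ L ((i : ℤ) - h)
        + ∑ i ∈ Finset.range (2 * h + 1),
          (oddWindow δ hδ L 0 - oddWindow δ hδ L ((i : ℤ) - h)) := by
    rw [Finset.sum_sub_distrib]
    simp
  have h3 : ‖∑ i ∈ Finset.range (2 * h + 1),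
      (oddWindow δ hδ L 0 - oddWindow δ hδ L ((i : ℤ) - h))‖ ≤ (2 * h + 1 : ℝ) ^ 2 / 2 := by
    refine (norm_sum_le _ _).trans ((Finset.sum_le_sum fun i _ => h1 i).trans ?_)
    rw [← Finset.mul_sum, ← Int.cast_sum, sum_abs_sub]
    push_cast
    nlinarith
  have h4 := congrArg norm h2
  rw [norm_mul, Complex.norm_natCast] at h4
  push_cast at h4
  rw [h4]
  exact (norm_add_le _ _).trans (add_le_add_right h3 _)

/-- After Fourier expansion the double sum over shift and position factors, at each frequency, into
a unimodular phase and two geometric sums in the same root of unity. Even frequencies drop out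
because χ vanishes there. -/
lemma norm_sum_oddWindow_le {δ : ℤ} (hδ : δ ≠ 0) (hsq : Squarefree δ) (h4 : ¬ δ ≡ 1 [ZMOD 4])
    (L h : ℕ) :
    √(4 * δ.natAbs : ℝ) * ‖∑ i ∈ Finset.range (2 * h + 1), oddWindow δ hδ L ((i : ℤ) - h)‖
      ≤ ∑ i ∈ Finset.range (2 * δ.natAbs), geomProd δ.natAbs (2 * h + 1) L (2 * i + 1) := by
  have hne : NeZero (4 * δ.natAbs) := ⟨by have := Int.natAbs_pos.2 hδ; omega⟩
  obtain ⟨C, hC, hexp⟩ := exists_gaussSum_expansion hδ hsq h4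
  set H := 2 * h + 1 with hH
  set χ := kroneckerChar δ hδ with hχ
  have key : C * ∑ i ∈ Finset.range H, oddWindow δ hδ L ((i : ℤ) - h)
      = ∑ x : ZMod (4 * δ.natAbs), ZMod.stdAddChar (-(x * (1 - 2 * (h : ZMod (4 * δ.natAbs))))) *
        (∑ i ∈ Finset.range H, ZMod.stdAddChar (-(2 * x)) ^ i) *
        (∑ i ∈ Finset.range L, ZMod.stdAddChar (-(2 * x)) ^ i) * χ x := by
    have hterm : ∀ i m : ℕ,
        C * χ (((2 * (((i : ℤ) - h) + m) + 1 : ℤ) : ZMod (4 * δ.natAbs)))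
        = ∑ x : ZMod (4 * δ.natAbs), ZMod.stdAddChar (-(x * (1 - 2 * (h : ZMod (4 * δ.natAbs))))) *
          (ZMod.stdAddChar (-(2 * x)) ^ i * ZMod.stdAddChar (-(2 * x)) ^ m) * χ x := by
      intro i m
      rw [hexp]
      refine Finset.sum_congr rfl fun x _ => ?_
      rw [← AddChar.map_nsmul_eq_pow, ← AddChar.map_nsmul_eq_pow, ← AddChar.map_add_eq_mul,
        ← AddChar.map_add_eq_mul]
      congr 2
      simp only [nsmul_eq_mul]
      push_cast
      ring
    calc _ = ∑ i ∈ Finset.range H, ∑ m ∈ Finset.range L,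
          C * χ (((2 * (((i : ℤ) - h) + m) + 1 : ℤ) : ZMod (4 * δ.natAbs))) := by
          unfold oddWindow
          simp only [Finset.mul_sum, hχ]
      _ = ∑ i ∈ Finset.range H, ∑ x : ZMod (4 * δ.natAbs), ∑ m ∈ Finset.range L, _ :=
          Finset.sum_congr rfl fun i _ => by
            rw [Finset.sum_congr rfl fun m _ => hterm i m, Finset.sum_comm]
      _ = _ := by
          rw [Finset.sum_comm]
          refine Finset.sum_congr rfl fun x _ => ?_
          rw [mul_assoc (ZMod.stdAddChar _), Finset.sum_mul_sum]
          simp only [Finset.mul_sum, Finset.sum_mul]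
  have hn := congrArg norm key
  rw [norm_mul, hC] at hn
  rw [hn, sum_zmod_eq_sum_range, ← sum_range_odd (fun v => geomProd δ.natAbs H L v),
    show 2 * (2 * δ.natAbs) = 4 * δ.natAbs by ring]
  refine (norm_sum_le _ _).trans (Finset.sum_le_sum fun v _ => ?_)
  split_ifs with hv
  · rw [norm_mul, norm_mul, norm_mul, norm_stdAddChar, one_mul, stdAddChar_neg_two_mul]
    exact mul_le_of_le_one_right (geomProd_nonneg _ _ _ _) (norm_kroneckerChar_le δ hδ _)
  · rw [hχ, kroneckerChar_natCast, kroneckerSym_even δ (Nat.not_odd_iff_even.1 hv)]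
    simp

/-- χ vanishes at even integers, and there are (K + 1)/2, rounded down, odd ones up to K. -/
lemma sum_kroneckerSym_eq_oddWindow (δ : ℤ) (hδ : δ ≠ 0) (K : ℕ) :
    ((∑ n ∈ Finset.Icc 1 K, kroneckerSym (4 * δ) n : ℤ) : ℂ)
      = oddWindow δ hδ ((K + 1) / 2) 0 := by
  have h1 : ∑ n ∈ Finset.Icc 1 K, kroneckerSym (4 * δ) n
      = ∑ i ∈ Finset.range ((K + 1) / 2), kroneckerSym (4 * δ) (2 * i + 1) := by
    induction K with
    | zero => simp
    | succ K ih =>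
      rw [Finset.sum_Icc_succ_top (by omega), ih]
      rcases Nat.even_or_odd' K with ⟨k, hk | hk⟩
      · rw [show (K + 1 + 1) / 2 = k + 1 by omega, show (K + 1) / 2 = k by omega,
          Finset.sum_range_succ, hk]
      · rw [kroneckerSym_even δ ⟨k + 1, by omega⟩, add_zero,
          show (K + 1 + 1) / 2 = (K + 1) / 2 by omega]
  rw [h1, oddWindow]
  push_cast
  refine Finset.sum_congr rfl fun i _ => ?_
  rw [← kroneckerChar_natCast δ hδ]
  congr 1
  push_cast; ring

/-- A Pólya–Vinogradov inequality with free smoothing length `2h + 1` and cut-off `B`. -/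
theorem abs_sum_kroneckerSym_le_sin {δ : ℤ} (hδ : δ ≠ 0) (hsq : Squarefree δ)
    (h4 : ¬ δ ≡ 1 [ZMOD 4]) (K h B : ℕ) (hB : 2 * B ≤ δ.natAbs + 1) :
    |((∑ n ∈ Finset.Icc 1 K, kroneckerSym (4 * δ) n : ℤ) : ℝ)|
      ≤ (2 * h + 1) / 2 + 2 / √(δ.natAbs : ℝ) *
        (∑ i ∈ Finset.range B, 1 / Real.sin (Real.pi * (2 * i + 1) / (2 * δ.natAbs))
        + 1 / (2 * h + 1) * ∑ i ∈ Finset.Ico B ((δ.natAbs + 1) / 2),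
          1 / Real.sin (Real.pi * (2 * i + 1) / (2 * δ.natAbs)) ^ 2) := by
  have hD : 0 < δ.natAbs := Int.natAbs_pos.2 hδ
  have hDr : (0 : ℝ) < δ.natAbs := by exact_mod_cast hD
  set L := (K + 1) / 2
  have a1 := norm_oddWindow_le_average δ hδ L h
  have a2 := norm_sum_oddWindow_le hδ hsq h4 L h
  have a3 := sum_geomProd_le hD (2 * h + 1) L B hB
  have a4 : |((∑ n ∈ Finset.Icc 1 K, kroneckerSym (4 * δ) n : ℤ) : ℝ)| = ‖oddWindow δ hδ L 0‖ := by
    rw [← sum_kroneckerSym_eq_oddWindow, ← Real.norm_eq_abs, ← Complex.norm_real]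
    push_cast; rfl
  have hs : √(4 * δ.natAbs : ℝ) = 2 * √(δ.natAbs : ℝ) := by
    rw [Real.sqrt_mul (by norm_num), show (4 : ℝ) = 2 ^ 2 by norm_num, Real.sqrt_sq (by norm_num)]
  have hs0 : 0 < √(δ.natAbs : ℝ) := Real.sqrt_pos.2 hDr
  rw [hs] at a2
  rw [a4]
  generalize ‖∑ i ∈ Finset.range (2 * h + 1), oddWindow δ hδ L ((i : ℤ) - h)‖ = T at a1 a2
  generalize ‖oddWindow δ hδ L 0‖ = S at a1 ⊢
  have a5 := a2.trans a3
  push_cast at a5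
  set P := ∑ i ∈ Finset.range B, 1 / Real.sin (Real.pi * (2 * i + 1) / (2 * δ.natAbs))
  set Q := ∑ i ∈ Finset.Ico B ((δ.natAbs + 1) / 2),
          1 / Real.sin (Real.pi * (2 * i + 1) / (2 * δ.natAbs)) ^ 2
  set s := √(δ.natAbs : ℝ)
  have hH : (0 : ℝ) < 2 * h + 1 := by positivity
  have a6 : T ≤ 2 / s * ((2 * h + 1) * P + Q) := by
    rw [div_mul_eq_mul_div, le_div_iff₀ hs0]; linarith
  rw [← mul_le_mul_iff_right₀ hH]
  calc _ ≤ _ := a1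
    _ ≤ 2 / s * ((2 * h + 1) * P + Q) + (2 * h + 1 : ℝ) ^ 2 / 2 := by linarith
    _ = _ := by field_simp; ring

/-! ### Sums of reciprocals of sines. -/

lemma sq_le_of_le_half_pi {x : ℝ} (h0 : 0 < x) (hx : x ≤ Real.pi / 2) : x ^ 2 ≤ 2.4675 := by
  have := Real.pi_lt_d4
  have h : x ≤ 1.5708 := by linarith
  nlinarith

/-- From sin x ≥ x - x³/6; the constant 0.284 keeps (1 + 0.284 t)(1 - t/6) ≥ 1 for t = x² up to
2.4675, just above π²/4. The constant 0.766 below has the same origin. -/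
lemma inv_sin_le {x : ℝ} (h0 : 0 < x) (hx : x ≤ Real.pi / 2) :
    1 / Real.sin x ≤ 1 / x + 0.284 * x := by
  have hx2 := sq_le_of_le_half_pi h0 hx
  have hs := Real.sin_ge_sub_cube h0.le
  have hpos : 0 < x - x ^ 3 / 6 := by
    have : x - x ^ 3 / 6 = x * (1 - x ^ 2 / 6) := by ring
    rw [this]; apply mul_pos h0; linarith
  refine (one_div_le_one_div_of_le hpos hs).trans ?_
  rw [div_le_iff₀ hpos]
  have : (1 / x + 0.284 * x) * (x - x ^ 3 / 6) = (1 + 0.284 * x ^ 2) * (1 - x ^ 2 / 6) := by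
    field_simp
  rw [this]
  nlinarith [sq_nonneg x]

lemma inv_sin_sq_le {x : ℝ} (h0 : 0 < x) (hx : x ≤ Real.pi / 2) :
    1 / Real.sin x ^ 2 ≤ 1 / x ^ 2 + 0.766 := by
  have hx2 := sq_le_of_le_half_pi h0 hx
  have hs := Real.sin_ge_sub_cube h0.le
  have hpos : 0 < x - x ^ 3 / 6 := by
    have : x - x ^ 3 / 6 = x * (1 - x ^ 2 / 6) := by ring
    rw [this]; apply mul_pos h0; linarith
  have hs2 : (x - x ^ 3 / 6) ^ 2 ≤ Real.sin x ^ 2 := pow_le_pow_left₀ hpos.le hs 2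
  refine (one_div_le_one_div_of_le (by positivity) hs2).trans ?_
  rw [div_le_iff₀ (by positivity)]
  have : (1 / x ^ 2 + 0.766) * (x - x ^ 3 / 6) ^ 2 = (1 + 0.766 * x ^ 2) * (1 - x ^ 2 / 6) ^ 2 := by
    field_simp
  rw [this]
  obtain ⟨t, ht⟩ : ∃ t, t = x ^ 2 := ⟨_, rfl⟩
  rw [← ht] at hx2 ⊢
  have ht0 : 0 ≤ t := by rw [ht]; positivity
  have e : (1 + 0.766 * t) * (1 - t / 6) ^ 2 - 1
      = t * ((0.766 - 1 / 3) - (0.766 / 3 - 1 / 36) * t + 0.766 / 36 * t ^ 2) := by ring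
  have : 0 ≤ (0.766 - 1 / 3) - (0.766 / 3 - 1 / 36) * t + 0.766 / 36 * t ^ 2 := by nlinarith
  have := mul_nonneg ht0 this
  linarith

lemma sum_inv_odd_le {B : ℕ} (hB : 1 ≤ B) :
    ∑ i ∈ Finset.range B, 1 / (2 * (i : ℝ) + 1) ≤ 1 / 2 * Real.log B + 1 := by
  induction B, hB using Nat.le_induction with
  | base => simp
  | succ n hn ih =>
    rw [Finset.sum_range_succ]
    have := two_div_le_log_succ hn
    have e : 1 / (2 * (n : ℝ) + 1) = 1 / 2 * (2 / (2 * (n : ℝ) + 1)) := by ring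
    push_cast
    linarith

lemma sum_odd (B : ℕ) : ∑ i ∈ Finset.range B, (2 * (i : ℝ) + 1) = (B : ℝ) ^ 2 := by
  induction B with
  | zero => simp
  | succ n ih => rw [Finset.sum_range_succ, ih]; push_cast; ring

/-- Telescoping, since (2n + 1)² > 4n(n + 1). -/
lemma sum_inv_odd_sq_le {B E : ℕ} (hB : 1 ≤ B) (hBE : B ≤ E) :
    ∑ i ∈ Finset.Ico B E, 1 / (2 * (i : ℝ) + 1) ^ 2 ≤ 1 / (4 * (B : ℝ)) - 1 / (4 * (E : ℝ)) := by
  induction E, hBE using Nat.le_induction with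
  | base => simp
  | succ n hn ih =>
    rw [Finset.sum_Ico_succ_top hn]
    have h1 : (1 : ℝ) ≤ n := by exact_mod_cast hB.trans hn
    have : 1 / (2 * (n : ℝ) + 1) ^ 2 ≤ 1 / (4 * n) - 1 / (4 * ((n + 1 : ℕ) : ℝ)) := by
      push_cast
      rw [div_sub_div _ _ (by positivity) (by positivity),
        div_le_div_iff₀ (by positivity) (by positivity)]
      nlinarith
    linarith

lemma sum_inv_sin_le {D B : ℕ} (hB : 1 ≤ B) (hBD : 2 * B ≤ D + 1) :
    ∑ i ∈ Finset.range B, 1 / Real.sin (Real.pi * (2 * i + 1) / (2 * D))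
      ≤ 2 * D / Real.pi * (1 / 2 * Real.log B + 1) + 0.284 * (Real.pi / (2 * D)) * B ^ 2 := by
  have hD : (0 : ℝ) < D := by exact_mod_cast (by omega : 0 < D)
  have hpi := Real.pi_pos
  calc _ ≤ ∑ i ∈ Finset.range B, (2 * D / Real.pi * (1 / (2 * (i : ℝ) + 1))
        + 0.284 * (Real.pi / (2 * D)) * (2 * (i : ℝ) + 1)) := by
        refine Finset.sum_le_sum fun i hi => ?_
        rw [Finset.mem_range] at hi
        refine (inv_sin_le (by positivity) ?_).trans (le_of_eq ?_)
        · rw [div_le_div_iff₀ (by positivity) (by norm_num)]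
          have : (2 * (i : ℝ) + 1) ≤ D := by exact_mod_cast (by omega : 2 * i + 1 ≤ D)
          nlinarith
        · field_simp
    _ = 2 * D / Real.pi * ∑ i ∈ Finset.range B, (1 / (2 * (i : ℝ) + 1))
        + 0.284 * (Real.pi / (2 * D)) * B ^ 2 := by
        rw [Finset.sum_add_distrib, ← Finset.mul_sum, ← Finset.mul_sum, sum_odd]
    _ ≤ _ := by
        have := mul_le_mul_of_nonneg_left (sum_inv_odd_le hB) (show 0 ≤ 2 * D / Real.pi by positivity)
        linarith

lemma sum_inv_sin_sq_le {D B : ℕ} (hB : 1 ≤ B) (hBD : 2 * B ≤ D + 1) :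
    ∑ i ∈ Finset.Ico B ((D + 1) / 2), 1 / Real.sin (Real.pi * (2 * i + 1) / (2 * D)) ^ 2
      ≤ D ^ 2 / Real.pi ^ 2 / B + 0.766 * ((D - 1) / 2) := by
  have hD : (0 : ℝ) < D := by exact_mod_cast (by omega : 0 < D)
  have hpi := Real.pi_pos
  have hB0 : (0 : ℝ) < B := by exact_mod_cast hB
  calc _ ≤ ∑ i ∈ Finset.Ico B ((D + 1) / 2), (4 * D ^ 2 / Real.pi ^ 2 * (1 / (2 * (i : ℝ) + 1) ^ 2)
        + 0.766) := by
        refine Finset.sum_le_sum fun i hi => ?_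
        rw [Finset.mem_Ico] at hi
        refine (inv_sin_sq_le (by positivity) ?_).trans (le_of_eq ?_)
        · rw [div_le_div_iff₀ (by positivity) (by norm_num)]
          have : (2 * (i : ℝ) + 1) ≤ D := by exact_mod_cast (by omega : 2 * i + 1 ≤ D)
          nlinarith
        · field_simp
          ring
    _ = 4 * D ^ 2 / Real.pi ^ 2 * ∑ i ∈ Finset.Ico B ((D + 1) / 2), (1 / (2 * (i : ℝ) + 1) ^ 2)
        + 0.766 * ((((D + 1) / 2 - B : ℕ)) : ℝ) := by
        rw [Finset.sum_add_distrib, ← Finset.mul_sum, Finset.sum_const, Nat.card_Ico, nsmul_eq_mul,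
          mul_comm (0.766 : ℝ)]
    _ ≤ 4 * D ^ 2 / Real.pi ^ 2 * (1 / (4 * B)) + 0.766 * ((D - 1) / 2) := by
        have h1 := sum_inv_odd_sq_le hB (show B ≤ (D + 1) / 2 by omega)
        have h2 : (0 : ℝ) ≤ 1 / (4 * ((D + 1) / 2 : ℕ)) := by positivity
        have h3 := mul_le_mul_of_nonneg_left (h1.trans (sub_le_self _ h2))
          (show 0 ≤ 4 * D ^ 2 / Real.pi ^ 2 by positivity)
        have h4 : ((((D + 1) / 2 - B : ℕ)) : ℝ) ≤ (D - 1) / 2 := by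
          rw [le_div_iff₀ (by norm_num), le_sub_iff_add_le]
          exact_mod_cast (by omega : ((D + 1) / 2 - B) * 2 + 1 ≤ D)
        linarith
    _ = _ := by field_simp

/-! ### Choice of the smoothing length and the cut-off. -/

/-- From log s ≥ 2(s - 1)/(s + 1), with the convex 1/(s + 1) replaced by its tangent at s + 1 = a.
The minorant is linear in s, which makes the later numerical checks linear. -/
lemma tangent_le_mul_log {s a : ℝ} (hs : 1 ≤ s) (ha : 0 < a) :
    2 * (s - 2 + 2 * (2 / a - (s + 1) / a ^ 2)) ≤ s * Real.log s := by
  have h1 := Real.le_log_one_add_of_nonneg (x := s - 1) (by linarith)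
  rw [show 1 + (s - 1) = s by ring, show s - 1 + 2 = s + 1 by ring] at h1
  have h2 : 2 / a - (s + 1) / a ^ 2 ≤ 1 / (s + 1) := by
    have h0 : 0 < s + 1 := by linarith
    rw [div_sub_div _ _ ha.ne' (by positivity), div_le_div_iff₀ (by positivity) h0]
    nlinarith [mul_nonneg ha.le (sq_nonneg (s + 1 - a))]
  have h3 : 2 * (s - 2 + 2 * (1 / (s + 1))) = s * (2 * (s - 1) / (s + 1)) := by
    have : s + 1 ≠ 0 := by linarith
    field_simp; ring
  have h4 := mul_le_mul_of_nonneg_left h1 (show 0 ≤ s by linarith)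
  linarith

lemma sq_bounds {p : ℝ} (hp1 : 0.3183 < p) (hp2 : p < 0.31832) :
    0.1013 < p ^ 2 ∧ p ^ 2 < 0.10133 := by
  constructor <;> nlinarith

lemma inv_pi_bounds : 0.3183 < 1 / Real.pi ∧ 1 / Real.pi < 0.31832 := by
  have h1 := Real.pi_gt_d4
  have h2 := Real.pi_lt_d4
  rw [lt_div_iff₀ Real.pi_pos, div_lt_iff₀ Real.pi_pos]
  constructor <;> nlinarith

/-- The range s = √D < 5 with cut-off B = 1 and smoothing lengths 1, 3, 5. On each subinterval s³
lies below its chord and s log s above a linear minorant. The decimals bound 4/π, 0.284π, 2/π² from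
above and 2/π, log 2 from below. -/
lemma smoothed_bound_aux {s w : ℝ} (hs : 1 ≤ s) (hw0 : 0 < w) (hws : w * s = 1) (hs5 : s < 5) :
    ∃ h : ℕ, (2 * h + 1 : ℝ) / 2 + 1.27328 * s + 0.8923 * w ^ 3
        + (1 / (2 * h + 1)) * (0.20266 * s ^ 3 + 0.766 * (s - w))
        ≤ 0.6366 * (0.693147 * s + s * Real.log s) + 1.6408 * s + 1.0285 := by
  have hw1 : w ≤ 1 := by nlinarith
  obtain ⟨l, hl⟩ : ∃ l, l = s * Real.log s := ⟨_, rfl⟩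
  rcases lt_or_ge s 1.5 with c1 | c1
  · refine ⟨0, ?_⟩
    have ht := tangent_le_mul_log (a := 2.2) hs (by norm_num)
    rw [← hl] at ht ⊢
    have hw3 : 0.8923 * w ^ 3 - 0.766 * w ≤ 0.1263 := by
      nlinarith [mul_nonneg hw0.le (show 0 ≤ 1 - w ^ 2 by nlinarith)]
    have hs3 : s ^ 3 ≤ 4.75 * s - 3.75 := by
      nlinarith [mul_nonneg (mul_nonneg (sub_nonneg.2 hs) (sub_nonneg.2 c1.le))
        (show 0 ≤ s + 2.5 by linarith)]
    norm_num at ht ⊢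
    linarith
  rcases lt_or_ge s 3 with c2 | c2
  · refine ⟨1, ?_⟩
    have ht := tangent_le_mul_log (a := 3.2) hs (by norm_num)
    rw [← hl] at ht ⊢
    have hw2 : w ≤ 2 / 3 := by nlinarith
    have hw3 := pow_le_pow_left₀ hw0.le hw2 3
    have hs3 : s ^ 3 ≤ 15.75 * s - 20.25 := by
      nlinarith [mul_nonneg (mul_nonneg (sub_nonneg.2 c1) (sub_nonneg.2 c2.le))
        (show 0 ≤ s + 4.5 by linarith)]
    norm_num at ht hw3 ⊢
    linarith
  · refine ⟨2, ?_⟩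
    have ht := tangent_le_mul_log (a := 5) hs (by norm_num)
    rw [← hl] at ht ⊢
    have hw2 : w ≤ 1 / 3 := by nlinarith
    have hw3 := pow_le_pow_left₀ hw0.le hw2 3
    have hs3 : s ^ 3 ≤ 49 * s - 120 := by
      nlinarith [mul_nonneg (mul_nonneg (sub_nonneg.2 c2) (sub_nonneg.2 hs5.le))
        (show 0 ≤ s + 8 by linarith)]
    norm_num at ht hw3 ⊢
    linarith

lemma window_ratio_bounds {s : ℝ} (hs : 5 ≤ s) :
    s ^ 2 / (1.2 * s - 1) ≤ 0.8334 * s + 0.8334 ∧ s / (1.2 * s - 1) ≤ 1 ∧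
      0.555 ≤ s ^ 2 / (1.2 * s - 1) / (s + 4) := by
  have h0 : 0 < 1.2 * s - 1 := by linarith
  refine ⟨?_, ?_, ?_⟩
  · rw [div_le_iff₀ h0]; nlinarith
  · rw [div_le_iff₀ h0]; linarith
  · rw [div_div, le_div_iff₀ (by positivity)]; nlinarith [sq_nonneg (s - 5)]

/-- The right-hand side is the chord over 0 ≤ e ≤ 4 of the left-hand side, which is convex in e. -/
lemma inv_cutoff_le {s e : ℝ} (hs : 0 < s) (he0 : 0 ≤ e) (he4 : e ≤ 4) :
    1 / ((s + e) / 4) ≤ 4 * (1 / s) * (1 - e / (s + 4)) := by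
  have : 1 - e / (s + 4) = (s + 4 - e) / (s + 4) := by field_simp
  rw [this, one_div_div, mul_one_div, div_mul_div_comm, div_le_div_iff₀ (by positivity)
    (by positivity)]
  nlinarith [mul_nonneg he0 (show 0 ≤ 4 - e by linarith)]

/-- The choice is smoothing length about 1.2s and B about s/4. Then log B is near log s - 2 log 2,
and the surplus 6 p s log 2 in the target pays for the remaining terms. -/
lemma smoothed_bound_large {s w p h B : ℝ} (c3 : 5 ≤ s) (hw : w = 1 / s)
    (hp1 : 0.3183 < p) (hp2 : p < 0.31832) (hfl1 : h ≤ 0.6 * s) (hfl2 : 0.6 * s < h + 1)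
    (hB1 : s / 4 < B) (hB2 : B ≤ s / 4 + 1) :
    (2 * h + 1 : ℝ) / 2 + 2 * p * s * Real.log B + 4 * p * s
        + 0.284 * Real.pi * B ^ 2 * w ^ 3
        + (1 / (2 * h + 1)) * (2 * p ^ 2 * s ^ 3 * (1 / B) + 0.766 * (s - w))
      ≤ p * s * (2 * Real.log 2 + 2 * Real.log s) + 1.6408 * s + 1.0285 := by
  have hs1 : 1 ≤ s := by linarith
  have hpi := Real.pi_pos
  have hpi2 := Real.pi_lt_d4
  have hl1 := Real.log_two_gt_d9
  obtain ⟨hpp2, hpp1⟩ := sq_bounds hp1 hp2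
  have hws : w * s = 1 := by rw [hw]; field_simp
  have hw0 : 0 < w := by rw [hw]; positivity
  have hw1 : w ≤ 1 := by nlinarith
  have hB0 : 0 < B := by linarith
  -- The rounding error of B. It costs 2pe through log B and gains 0.449e through 1/B; both are kept
  -- until the end so that they offset each other.
  obtain ⟨e, he⟩ : ∃ e, e = 4 * B - s := ⟨_, rfl⟩
  have he0 : 0 < e := by linarith
  have he4 : e ≤ 4 := by linarith
  have hlogB : Real.log B ≤ Real.log s + e * w - 2 * Real.log 2 := by
    have h1 := Real.log_le_sub_one_of_pos (show 0 < 4 * B / s by positivity)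
    rw [Real.log_div (by positivity) (by positivity), Real.log_mul (by norm_num) hB0.ne',
      show (4 : ℝ) = 2 ^ 2 by norm_num, Real.log_pow] at h1
    have h2 : 2 ^ 2 * B / s - 1 = e * w := by
      rw [he, hw]; field_simp; ring
    push_cast at h1
    linarith
  have hH1 : 1.2 * s - 1 ≤ 2 * h + 1 := by linarith
  have hH0 : 0 < 1.2 * s - 1 := by linarith
  have hinvH : 1 / (2 * h + 1) ≤ 1 / (1.2 * s - 1) := one_div_le_one_div_of_le hH0 hH1
  have hinvB : 1 / B ≤ 4 * w * (1 - e / (s + 4)) := by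
    have hB' : B = (s + e) / 4 := by linarith
    rw [hB', hw]
    exact inv_cutoff_le (by linarith) he0.le he4
  have t1 : 2 * p * s * Real.log B ≤ 2 * p * s * (Real.log s - 2 * Real.log 2) + 2 * p * e := by
    have := mul_le_mul_of_nonneg_left hlogB (show 0 ≤ 2 * p * s by positivity)
    have e1 : 2 * p * s * (e * w) = 2 * p * e := by linear_combination 2 * p * e * hws
    linarith
  have t2 : 0.284 * Real.pi * B ^ 2 * w ^ 3 ≤ 0.04 := by
    have hBs : B * w ≤ 0.45 := by
      have : B ≤ 0.45 * s := by linarith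
      calc B * w ≤ 0.45 * s * w := mul_le_mul_of_nonneg_right this hw0.le
        _ = 0.45 := by linear_combination 0.45 * hws
    have hBs2 : (B * w) ^ 2 ≤ 0.45 ^ 2 := pow_le_pow_left₀ (by positivity) hBs 2
    have hw5 : w ≤ 0.2 := by rw [hw, div_le_iff₀ (by linarith)]; linarith
    calc 0.284 * Real.pi * B ^ 2 * w ^ 3 = (0.284 * Real.pi) * ((B * w) ^ 2 * w) := by ring
      _ ≤ 0.893 * (0.45 ^ 2 * 0.2) := by
          apply mul_le_mul (by linarith) _ (by positivity) (by norm_num)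
          exact mul_le_mul hBs2 hw5 hw0.le (by norm_num)
      _ ≤ 0.04 := by norm_num
  have t3 : (1 / (2 * h + 1)) * (2 * p ^ 2 * s ^ 3 * (1 / B) + 0.766 * (s - w))
      ≤ (1 / (1.2 * s - 1)) * (8 * p ^ 2 * s ^ 2 * (1 - e / (s + 4)) + 0.766 * s) := by
    apply mul_le_mul hinvH _ _ (by positivity)
    · have h1 := mul_le_mul_of_nonneg_left hinvB (show 0 ≤ 2 * p ^ 2 * s ^ 3 by positivity)
      have e1 : 2 * p ^ 2 * s ^ 3 * (4 * w * (1 - e / (s + 4)))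
          = 8 * p ^ 2 * s ^ 2 * (1 - e / (s + 4)) := by
        linear_combination 8 * p ^ 2 * s ^ 2 * (1 - e / (s + 4)) * hws
      linarith
    · have : 0 ≤ s - w := by linarith
      positivity
  have t4 : (1 / (1.2 * s - 1)) * (8 * p ^ 2 * s ^ 2 * (1 - e / (s + 4)) + 0.766 * s)
      ≤ 0.81064 * (0.8334 * s + 0.8334) - 0.449 * e + 0.766 := by
    obtain ⟨g1, g2, g3⟩ := window_ratio_bounds c3
    have e1 : (1 / (1.2 * s - 1)) * (8 * p ^ 2 * s ^ 2 * (1 - e / (s + 4)) + 0.766 * s)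
        = 8 * p ^ 2 * (s ^ 2 / (1.2 * s - 1))
          - 8 * p ^ 2 * (e * (s ^ 2 / (1.2 * s - 1) / (s + 4)))
          + 0.766 * (s / (1.2 * s - 1)) := by ring
    rw [e1]
    have g4 : 8 * p ^ 2 * (s ^ 2 / (1.2 * s - 1)) ≤ 0.81064 * (0.8334 * s + 0.8334) :=
      mul_le_mul (by linarith) g1 (by positivity) (by norm_num)
    have g5 : 0.8104 * (e * 0.555)
        ≤ 8 * p ^ 2 * (e * (s ^ 2 / (1.2 * s - 1) / (s + 4))) :=
      mul_le_mul (by linarith) (mul_le_mul_of_nonneg_left g3 he0.le) (by positivity)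
        (by positivity)
    linarith
  have t5 : 2 * p * s * (Real.log s - 2 * Real.log 2)
      ≤ p * s * (2 * Real.log 2 + 2 * Real.log s) - 1.3236 * s := by
    have : 1.3236 * s ≤ 6 * (p * s) * Real.log 2 := by
      have b1 : 0.3183 * s ≤ p * s := mul_le_mul_of_nonneg_right hp1.le (by linarith)
      have b2 := mul_le_mul_of_nonneg_left hl1.le (show 0 ≤ p * s by positivity)
      linarith
    linarith
  linarith [mul_le_mul_of_nonneg_right hp2.le he0.le, mul_le_mul_of_nonneg_right hp2.le (show 0 ≤ s by linarith)]

/-- The numerical form of the smoothed bound, with `p = 1 / π` and `H = 2 h + 1`. -/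
lemma exists_smoothing_parameters {D : ℕ} (hD : 1 ≤ D) :
    ∃ h B : ℕ, 1 ≤ B ∧ 2 * B ≤ D + 1 ∧
      (2 * h + 1 : ℝ) / 2 + 2 / √(D : ℝ) *
        (2 * D / Real.pi * (1 / 2 * Real.log B + 1) + 0.284 * (Real.pi / (2 * D)) * B ^ 2
        + 1 / (2 * h + 1) * (D ^ 2 / Real.pi ^ 2 / B + 0.766 * ((D - 1) / 2)))
      ≤ 1 / Real.pi * √(D : ℝ) * Real.log (4 * D) + 1.6408 * √(D : ℝ) + 1.0285 := by
  obtain ⟨s, hs⟩ : ∃ s, s = √(D : ℝ) := ⟨_, rfl⟩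
  obtain ⟨p, hp⟩ : ∃ p, p = 1 / Real.pi := ⟨_, rfl⟩
  obtain ⟨hp1, hp2⟩ := inv_pi_bounds
  rw [← hp] at hp1 hp2
  have hDr : (1 : ℝ) ≤ D := by exact_mod_cast hD
  have hs2 : s ^ 2 = D := by rw [hs]; exact Real.sq_sqrt (by positivity)
  have hs1 : 1 ≤ s := by rw [hs]; exact Real.one_le_sqrt.2 hDr
  have hpi := Real.pi_pos
  have hpi2 := Real.pi_lt_d4
  have hl1 := Real.log_two_gt_d9
  obtain ⟨hpp2, hpp1⟩ := sq_bounds hp1 hp2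
  have hlog : Real.log (4 * D) = 2 * Real.log 2 + 2 * Real.log s := by
    rw [← hs2, show (4 : ℝ) * s ^ 2 = (2 * s) ^ 2 by ring, Real.log_pow,
      Real.log_mul (by norm_num) (by positivity)]
    push_cast; ring
  have hform : ∀ h B : ℕ, 1 ≤ B →
      (2 * h + 1 : ℝ) / 2 + 2 / √(D : ℝ) *
        (2 * D / Real.pi * (1 / 2 * Real.log B + 1) + 0.284 * (Real.pi / (2 * D)) * B ^ 2
        + 1 / (2 * h + 1) * (D ^ 2 / Real.pi ^ 2 / B + 0.766 * ((D - 1) / 2)))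
      = (2 * h + 1 : ℝ) / 2 + 2 * p * s * Real.log B + 4 * p * s
        + 0.284 * Real.pi * B ^ 2 * (1 / s) ^ 3
        + (1 / (2 * h + 1)) * (2 * p ^ 2 * s ^ 3 * (1 / B) + 0.766 * (s - 1 / s)) := by
    intro h B hB
    have hB0 : (0 : ℝ) < B := by exact_mod_cast hB
    have hs0 : s ≠ 0 := by linarith
    rw [← hs, ← hs2, hp]
    field_simp
    ring
  obtain ⟨w, hw⟩ : ∃ w, w = 1 / s := ⟨_, rfl⟩
  have hws : w * s = 1 := by rw [hw]; field_simp
  have hw0 : 0 < w := by rw [hw]; positivity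
  have hw1 : w ≤ 1 := by nlinarith
  have hB1 : ∀ h : ℕ, (2 * h + 1 : ℝ) / 2 + 1.27328 * s + 0.8923 * w ^ 3
        + (1 / (2 * h + 1)) * (0.20266 * s ^ 3 + 0.766 * (s - w))
        ≤ 0.6366 * (0.693147 * s + s * Real.log s) + 1.6408 * s + 1.0285 →
      (2 * h + 1 : ℝ) / 2 + 2 / √(D : ℝ) *
        (2 * D / Real.pi * (1 / 2 * Real.log (1 : ℕ) + 1)
          + 0.284 * (Real.pi / (2 * D)) * ((1 : ℕ) : ℝ) ^ 2
        + 1 / (2 * h + 1) * (D ^ 2 / Real.pi ^ 2 / (1 : ℕ) + 0.766 * ((D - 1) / 2)))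
      ≤ 1 / Real.pi * √(D : ℝ) * Real.log (4 * D) + 1.6408 * √(D : ℝ) + 1.0285 := by
    intro h hh
    rw [hform h 1 le_rfl, hlog, ← hs, ← hp, ← hw]
    push_cast
    rw [Real.log_one]
    have hlogs : 0 ≤ Real.log s := Real.log_nonneg hs1
    have a1 : 0.284 * Real.pi * w ^ 3 ≤ 0.8923 * w ^ 3 := by
      apply mul_le_mul_of_nonneg_right _ (by positivity); linarith
    have a2 : (1 / (2 * h + 1 : ℝ)) * (2 * p ^ 2 * s ^ 3)
        ≤ (1 / (2 * h + 1 : ℝ)) * (0.20266 * s ^ 3) := by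
      apply mul_le_mul_of_nonneg_left _ (by positivity)
      apply mul_le_mul_of_nonneg_right _ (by positivity); linarith
    have a3 : 4 * p * s ≤ 1.27328 * s :=
      mul_le_mul_of_nonneg_right (by linarith) (by linarith)
    have a4 : 0.6366 * (0.693147 * s + s * Real.log s)
        ≤ p * s * (2 * Real.log 2 + 2 * Real.log s) := by
      have b1 : 0 ≤ s * Real.log s := by positivity
      have b2 : 0.693147 * s + s * Real.log s ≤ s * Real.log 2 + s * Real.log s := by
        have := mul_le_mul_of_nonneg_left hl1.le (show 0 ≤ s by linarith)
        linarith
      have b3 : 0.6366 * (0.693147 * s + s * Real.log s)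
          ≤ 2 * p * (s * Real.log 2 + s * Real.log s) :=
        mul_le_mul (by linarith) b2 (by positivity) (by linarith)
      linarith
    linarith
  rcases lt_or_ge s 5 with c3 | c3
  · obtain ⟨h, hh⟩ := smoothed_bound_aux hs1 hw0 hws c3
    exact ⟨h, 1, le_rfl, by omega, hB1 h hh⟩
  · have hfl1 := Nat.floor_le (show 0 ≤ 0.6 * s by positivity)
    have hfl2 := Nat.lt_floor_add_one (0.6 * s)
    have hfB1 := Nat.floor_le (show 0 ≤ s / 4 by positivity)
    have hfB2 := Nat.lt_floor_add_one (s / 4)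
    refine ⟨⌊0.6 * s⌋₊, ⌊s / 4⌋₊ + 1, by omega, ?_, ?_⟩
    · have : (2 * (⌊s / 4⌋₊ + 1) : ℝ) ≤ D + 1 := by
        have := mul_le_mul_of_nonneg_left c3 (show 0 ≤ s by linarith)
        rw [← hs2, sq]; linarith
      exact_mod_cast this
    rw [hform _ _ (by omega), hlog, ← hs, ← hp, ← hw]
    push_cast
    exact smoothed_bound_large c3 hw hp1 hp2 hfl1 hfl2 hfB2 (by linarith)

/-- The estimate with the constants for δ < 0 is proved for both signs; it suffices for δ > 0
because 1/π ≤ 4/π² and the other two constants are larger there. -/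
theorem abs_sum_kroneckerSym_le {δ : ℤ} (hδ : δ ≠ 0) (hsq : Squarefree δ)
    (h4 : ¬ δ ≡ 1 [ZMOD 4]) (K : ℕ) :
    |((∑ n ∈ Finset.Icc 1 K, kroneckerSym (4 * δ) n : ℤ) : ℝ)| ≤ polyaConst δ := by
  have hD : 1 ≤ δ.natAbs := Int.natAbs_pos.2 hδ
  have hDr : (1 : ℝ) ≤ δ.natAbs := by exact_mod_cast hD
  obtain ⟨h, B, hB, hBD, hbound⟩ := exists_smoothing_parameters hD
  have h1 := abs_sum_kroneckerSym_le_sin hδ hsq h4 K h B hBD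
  have h2 := sum_inv_sin_le hB hBD
  have h3 := sum_inv_sin_sq_le hB hBD
  have h5 := mul_le_mul_of_nonneg_left h3 (show (0 : ℝ) ≤ 1 / (2 * h + 1) by positivity)
  have h6 := mul_le_mul_of_nonneg_left (add_le_add h2 h5)
    (show 0 ≤ 2 / √(δ.natAbs : ℝ) by positivity)
  refine (h1.trans (add_le_add_right h6 _)).trans (hbound.trans ?_)
  have habs : (δ.natAbs : ℝ) = |(δ : ℝ)| := by
    rw [Nat.cast_natAbs, Int.cast_abs]
  rw [habs] at hDr ⊢
  unfold polyaConst
  split_ifs with hpos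
  · have : |(δ : ℝ)| = δ := abs_of_pos (by exact_mod_cast hpos)
    rw [this] at hDr ⊢
    have hs0 : 0 ≤ √(δ : ℝ) := Real.sqrt_nonneg _
    have hl : 0 ≤ Real.log (4 * (δ : ℝ)) := Real.log_nonneg (by linarith)
    have hpi : 1 / Real.pi ≤ 4 / Real.pi ^ 2 := by
      rw [div_le_div_iff₀ Real.pi_pos (by positivity)]
      have := mul_le_mul_of_nonneg_left Real.pi_le_four Real.pi_pos.le
      rw [sq]; linarith
    have := mul_le_mul_of_nonneg_right (mul_le_mul_of_nonneg_right hpi hs0) hl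
    linarith
  · exact le_rfl

/-! ### Dirichlet's test with an explicit error. -/

lemma Icc_one_eq_Ioc_zero (n : ℕ) : Finset.Icc 1 n = Finset.Ioc 0 n := by
  ext; simp only [Finset.mem_Icc, Finset.mem_Ioc]; omega

section DirichletTest

variable {a : ℕ → ℝ} {M : ℝ}

/-- Partial summation: the increments telescope to M(1/(y + 1) - 1/(K + 1)), and the boundary terms
add M/(K + 1) + M/(y + 1). -/
lemma abs_sum_div_sub_le (hM : ∀ K, |∑ n ∈ Finset.Icc 1 K, a n| ≤ M) {y K : ℕ} (hyK : y ≤ K) :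
    |∑ n ∈ Finset.Icc 1 K, a n / n - ∑ n ∈ Finset.Icc 1 y, a n / n| ≤ 2 * M / ((y : ℝ) + 1) := by
  set A : ℕ → ℝ := fun K => ∑ n ∈ Finset.Icc 1 K, a n with hA
  set G : ℕ → ℝ := fun K => ∑ n ∈ Finset.Icc 1 K, a n / n with hG
  have hA1 : ∀ K, A (K + 1) = A K + a (K + 1) := fun K => Finset.sum_Icc_succ_top (by omega) _
  have hG1 : ∀ K, G (K + 1) = G K + a (K + 1) / ((K : ℝ) + 1) := fun K => by
    have := Finset.sum_Icc_succ_top (a := 1) (b := K) (by omega) (fun n : ℕ => a n / (n : ℝ))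
    rw [Nat.cast_add_one] at this
    exact this
  have hM' : ∀ K, |A K| ≤ M := hM
  have key : |(G K - A K / ((K : ℝ) + 1)) - (G y - A y / ((y : ℝ) + 1))|
      ≤ M * (1 / ((y : ℝ) + 1) - 1 / ((K : ℝ) + 1)) := by
    induction K, hyK using Nat.le_induction with
    | base => simp
    | succ n hn ih =>
      have e : G (n + 1) - A (n + 1) / (((n + 1 : ℕ) : ℝ) + 1) - (G y - A y / ((y : ℝ) + 1))
          = (G n - A n / ((n : ℝ) + 1) - (G y - A y / ((y : ℝ) + 1)))
            + A (n + 1) * (1 / ((n : ℝ) + 1) - 1 / (((n + 1 : ℕ) : ℝ) + 1)) := by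
        rw [hG1, show a (n + 1) = A (n + 1) - A n by rw [hA1]; ring]; ring
      have hnn : 0 ≤ 1 / ((n : ℝ) + 1) - 1 / (((n + 1 : ℕ) : ℝ) + 1) := by
        rw [sub_nonneg]
        apply one_div_le_one_div_of_le (by positivity)
        push_cast; linarith
      rw [e]
      refine (abs_add_le _ _).trans ?_
      rw [abs_mul, abs_of_nonneg hnn]
      have := mul_le_mul_of_nonneg_right (hM' (n + 1)) hnn
      linarith
  have e : G K - G y = ((G K - A K / ((K : ℝ) + 1)) - (G y - A y / ((y : ℝ) + 1)))
      + A K / ((K : ℝ) + 1) - A y / ((y : ℝ) + 1) := by ring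
  have h1 : |A K / ((K : ℝ) + 1)| ≤ M * (1 / ((K : ℝ) + 1)) := by
    rw [abs_div, abs_of_pos (show (0 : ℝ) < K + 1 by positivity), mul_one_div]
    exact div_le_div_of_nonneg_right (hM' K) (by positivity)
  have h2 : |A y / ((y : ℝ) + 1)| ≤ M * (1 / ((y : ℝ) + 1)) := by
    rw [abs_div, abs_of_pos (show (0 : ℝ) < y + 1 by positivity), mul_one_div]
    exact div_le_div_of_nonneg_right (hM' y) (by positivity)
  change |G K - G y| ≤ _
  rw [e]
  refine (abs_sub _ _).trans ((add_le_add (abs_add_le _ _) le_rfl).trans ?_)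
  have : 2 * M / ((y : ℝ) + 1) = 2 * (M * (1 / ((y : ℝ) + 1))) := by ring
  rw [this]
  linarith

lemma exists_tendsto_sum_div (hM : ∀ K, |∑ n ∈ Finset.Icc 1 K, a n| ≤ M) :
    ∃ L : ℝ, Tendsto (fun K : ℕ => ∑ n ∈ Finset.Icc 1 K, a n / (n : ℝ)) atTop (𝓝 L) := by
  apply cauchySeq_tendsto_of_complete
  refine cauchySeq_of_le_tendsto_0' (fun n : ℕ => 2 * M / ((n : ℝ) + 1)) ?_ ?_
  · intro n m hnm
    rw [Real.dist_eq, abs_sub_comm]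
    exact abs_sum_div_sub_le hM hnm
  · exact tendsto_const_nhds.div_atTop
      (tendsto_atTop_add_const_right _ _ tendsto_natCast_atTop_atTop)

lemma sum_div_le_add (hM : ∀ K, |∑ n ∈ Finset.Icc 1 K, a n| ≤ M) {L : ℝ}
    (hL : Tendsto (fun K : ℕ => ∑ n ∈ Finset.Icc 1 K, a n / (n : ℝ)) atTop (𝓝 L)) (y : ℕ) :
    ∑ n ∈ Finset.Icc 1 y, a n / (n : ℝ) ≤ L + 2 * M / ((y : ℝ) + 1) := by
  refine ge_of_tendsto (hL.add_const (2 * M / ((y : ℝ) + 1))) ?_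
  filter_upwards [eventually_ge_atTop y] with K hK
  have := neg_abs_le (∑ n ∈ Finset.Icc 1 K, a n / n - ∑ n ∈ Finset.Icc 1 y, a n / n)
  have := abs_sum_div_sub_le hM hK
  linarith

end DirichletTest

/-! ### Summatory functions of μ² * χ. -/

/-- An integer-valued arithmetic function divided by its argument. -/
noncomputable def divArg (f : ArithmeticFunction ℤ) : ArithmeticFunction ℝ :=
  ⟨fun n => (f n : ℝ) / n, by simp⟩

lemma divArg_apply (f : ArithmeticFunction ℤ) (n : ℕ) : divArg f n = (f n : ℝ) / n := rfl

lemma divArg_mul (f g : ArithmeticFunction ℤ) : divArg (f * g) = divArg f * divArg g := by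
  ext n
  rw [divArg_apply, ArithmeticFunction.mul_apply, ArithmeticFunction.mul_apply]
  push_cast
  rw [Finset.sum_div]
  refine Finset.sum_congr rfl fun x hx => ?_
  rw [divArg_apply, divArg_apply, ← (Nat.mem_divisorsAntidiagonal.1 hx).1]
  push_cast
  rw [div_mul_div_comm]

lemma sum_conv_le {δ : ℤ} {M : ℝ} (hM : ∀ K, |∑ n ∈ Finset.Icc 1 K, (kroneckerSym (4 * δ) n : ℝ)| ≤ M)
    (x : ℕ) :
    ∑ d ∈ Finset.Icc 1 x, ((sqfreeArith * kroneckerArith δ) d : ℝ) ≤ M * sqfreeCount x := by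
  have h := ArithmeticFunction.sum_Ioc_mul_eq_sum_sum sqfreeArith (kroneckerArith δ) x
  have h' : ∑ d ∈ Finset.Icc 1 x, ((sqfreeArith * kroneckerArith δ) d : ℝ)
      = ∑ l ∈ Finset.Icc 1 x, (sqfreeArith l : ℝ) *
        ∑ m ∈ Finset.Icc 1 (x / l), (kroneckerSym (4 * δ) m : ℝ) := by
    simp only [Icc_one_eq_Ioc_zero]
    exact_mod_cast congrArg (Int.cast (R := ℝ)) h
  rw [h', sqfreeCount, Finset.card_filter]
  push_cast
  rw [Finset.mul_sum]
  refine Finset.sum_le_sum fun l _ => ?_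
  rw [sqfreeArith_apply]
  split_ifs
  · have := (le_abs_self _).trans (hM (x / l))
    push_cast
    linarith
  · simp

/-- For each squarefree l the inner sum is at most L plus an error 2Ml/X; the outer weight 1/l
cancels the l, leaving 2M/X for each squarefree l. -/
lemma sum_conv_div_le {δ : ℤ} {M L : ℝ}
    (hM : ∀ K, |∑ n ∈ Finset.Icc 1 K, (kroneckerSym (4 * δ) n : ℝ)| ≤ M)
    (hL : Tendsto (fun K : ℕ => ∑ n ∈ Finset.Icc 1 K, (kroneckerSym (4 * δ) n : ℝ) / (n : ℝ))
      atTop (𝓝 L)) {x : ℕ} {X : ℝ} (hX : 0 < X) (hxX : X < x + 1) :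
    ∑ d ∈ Finset.Icc 1 x, ((sqfreeArith * kroneckerArith δ) d : ℝ) / d
      ≤ L * sqfreeRecip x + 2 * M / X * sqfreeCount x := by
  have hM0 : 0 ≤ M := (abs_nonneg _).trans (hM 0)
  have h := ArithmeticFunction.sum_Ioc_mul_eq_sum_sum (divArg sqfreeArith)
    (divArg (kroneckerArith δ)) x
  rw [← divArg_mul] at h
  simp only [divArg_apply, kroneckerArith_apply] at h
  simp only [← Icc_one_eq_Ioc_zero] at h
  rw [h, sqfreeRecip, sqfreeCount, Finset.card_filter, Finset.sum_filter]
  push_cast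
  rw [Finset.mul_sum, Finset.mul_sum, ← Finset.sum_add_distrib]
  refine Finset.sum_le_sum fun l hl => ?_
  have hl1 := (Finset.mem_Icc.1 hl).1
  have hl0 : (0 : ℝ) < l := by exact_mod_cast hl1
  rw [sqfreeArith_apply]
  split_ifs
  · have h1 := sum_div_le_add hM hL (x / l)
    -- (⌊x/l⌋ + 1) l is an integer exceeding x, hence at least x + 1 > X.
    have h2 : X / l ≤ ((x / l : ℕ) : ℝ) + 1 := by
      rw [div_le_iff₀ hl0]
      have h3 := Nat.lt_div_mul_add (a := x) (b := l) hl1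
      have h4 : (x : ℝ) + 1 ≤ (((x / l : ℕ) : ℝ) + 1) * l := by
        have : x + 1 ≤ (x / l + 1) * l := by rw [add_mul, one_mul]; exact h3
        exact_mod_cast this
      linarith
    have h3 : 2 * M / (((x / l : ℕ) : ℝ) + 1) ≤ 2 * M / (X / l) :=
      div_le_div_of_nonneg_left (by positivity) (by positivity) h2
    have h4 := mul_le_mul_of_nonneg_left (h1.trans (add_le_add_right h3 L))
      (show (0 : ℝ) ≤ 1 / l by positivity)
    push_cast
    refine h4.trans (le_of_eq ?_)
    field_simp
  · simp

/-- Primes are squarefree and their reciprocals have divergent sum. -/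
lemma not_bddAbove_sqfreeRecip (C : ℝ) : ∃ n, 1 ≤ n ∧ C < sqfreeRecip n := by
  by_contra! hc
  apply Nat.Primes.not_summable_one_div
  have := summable_of_sum_le (f := fun p : Nat.Primes => (1 / (p : ℝ))) (c := C)
    (fun p => by positivity) ?_
  · exact this
  intro s
  obtain ⟨N, hN⟩ : ∃ N : ℕ, ∀ p ∈ s, (p : ℕ) ≤ N :=
    ⟨s.sup (fun p => (p : ℕ)), fun p hp => Finset.le_sup (f := fun p : Nat.Primes => (p : ℕ)) hp⟩
  refine le_trans ?_ (hc (N + 1) (by omega))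
  unfold sqfreeRecip
  refine (le_of_eq (Finset.sum_map s ⟨fun p : Nat.Primes => (p : ℕ), Subtype.val_injective⟩
    (fun n : ℕ => 1 / (n : ℝ))).symm).trans ?_
  refine Finset.sum_le_sum_of_subset_of_nonneg ?_ (fun i _ _ => by positivity)
  intro n hn
  obtain ⟨p, hp, rfl⟩ := Finset.mem_map.1 hn
  exact Finset.mem_filter.2
    ⟨Finset.mem_Icc.2 ⟨p.2.one_lt.le, (hN p hp).trans (Nat.le_succ N)⟩, p.2.squarefree⟩

lemma rootCount_le_conv_real {δ : ℤ} (hsq : Squarefree δ) (h4 : ¬ δ ≡ 1 [ZMOD 4]) {d : ℕ}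
    (hd : 0 < d) : (rootCount δ d : ℝ) ≤ ((sqfreeArith * kroneckerArith δ) d : ℝ) := by
  exact_mod_cast (Int.cast_le (R := ℝ)).2 (rootCount_le_conv hsq h4 hd)

lemma sqfreeCount_le_self (n : ℕ) : sqfreeCount n ≤ n := by
  unfold sqfreeCount
  refine (Finset.card_filter_le _ _).trans ?_
  simp

/-- μ² * χ dominates a root count, so its sums are non-negative; they are also at most L R(n) + 2M,
which is negative for large n if L < 0, as R is unbounded. -/
lemma limit_nonneg {δ : ℤ} (hsq : Squarefree δ) (h4 : ¬ δ ≡ 1 [ZMOD 4]) {M L : ℝ}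
    (hM : ∀ K, |∑ n ∈ Finset.Icc 1 K, (kroneckerSym (4 * δ) n : ℝ)| ≤ M)
    (hL : Tendsto (fun K : ℕ => ∑ n ∈ Finset.Icc 1 K, (kroneckerSym (4 * δ) n : ℝ) / (n : ℝ))
      atTop (𝓝 L)) : 0 ≤ L := by
  have hM0 : 0 ≤ M := (abs_nonneg _).trans (hM 0)
  by_contra! hneg
  obtain ⟨n, hn1, hn⟩ := not_bddAbove_sqfreeRecip (2 * M / (-L))
  have hn0 : (0 : ℝ) < n := by exact_mod_cast hn1
  have h1 := sum_conv_div_le hM hL hn0 (lt_add_one (n : ℝ))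
  have h2 : 0 ≤ ∑ d ∈ Finset.Icc 1 n, ((sqfreeArith * kroneckerArith δ) d : ℝ) / d := by
    refine Finset.sum_nonneg fun d hd => ?_
    have := rootCount_le_conv_real hsq h4 (Finset.mem_Icc.1 hd).1
    have : (0 : ℝ) ≤ ((sqfreeArith * kroneckerArith δ) d : ℝ) := le_trans (by positivity) this
    positivity
  have h3 : 2 * M / n * sqfreeCount n ≤ 2 * M := by
    rw [div_mul_eq_mul_div, div_le_iff₀ hn0]
    exact mul_le_mul_of_nonneg_left (by exact_mod_cast sqfreeCount_le_self n) (by positivity)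
  rw [div_lt_iff₀ (by linarith)] at hn
  linarith

/-! ### From divisors of quadratic values to root counts. -/

/-- A zero of f would make δ a perfect square; being squarefree, δ would be 1, which is excluded
modulo 4. -/
lemma quad_pos {b c : ℤ} (hδsq : Squarefree (disc b c)) (hδ4 : ¬ disc b c ≡ 1 [ZMOD 4])
    (hf : ∀ n : ℤ, 1 ≤ n → 0 ≤ quad b c n) {n : ℤ} (hn : 1 ≤ n) : 0 < quad b c n := by
  refine lt_of_le_of_ne (hf n hn) fun h0 => hδ4 ?_
  have h : disc b c = (n + b) * (n + b) := by
    rw [quad] at h0; rw [disc]; linarith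
  have hu := hδsq (n + b) ⟨1, by rw [h, mul_one]⟩
  rcases Int.isUnit_iff.1 hu with h1 | h1 <;> rw [h, h1] <;> norm_num

/-- f(N) - f(n) = (N - n)(N + n + 2b); the case n = 1 shows N + 1 + 2b ≥ 0 when N > 1, and then the
second factor is non-negative for all n ≥ 1. -/
lemma quad_le {b c n N : ℤ} (hn : 1 ≤ n) (hnN : n ≤ N) (h1N : quad b c 1 ≤ quad b c N) :
    quad b c n ≤ quad b c N := by
  rcases hnN.eq_or_lt with rfl | hlt
  · exact le_rfl
  unfold quad at *
  have h1 : 0 ≤ (N - 1) * (N + 1 + 2 * b) := by linarith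
  have h2 : 0 ≤ N + 1 + 2 * b := nonneg_of_mul_nonneg_right h1 (by omega)
  have h3 : 0 ≤ (N - n) * (N + n + 2 * b) := mul_nonneg (by omega) (by omega)
  linarith

/-- The map d ↦ m/d injects the divisors above √m into those below. The cut-off √F, independent of
m, allows the later exchange of summations. -/
lemma card_divisors_le {m F : ℕ} (hmF : m ≤ F) :
    m.divisors.card ≤ 2 * ((Finset.Icc 1 F.sqrt).filter (fun d => d ∣ m)).card := by
  classical
  have h1 : (m.divisors.filter fun d => d * d ≤ m).card
      ≤ ((Finset.Icc 1 F.sqrt).filter (fun d => d ∣ m)).card := by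
    refine Finset.card_le_card fun d hd => ?_
    rw [Finset.mem_filter] at hd
    rw [Finset.mem_filter, Finset.mem_Icc]
    exact ⟨⟨Nat.pos_of_mem_divisors hd.1, Nat.le_sqrt.2 (hd.2.trans hmF)⟩,
      Nat.dvd_of_mem_divisors hd.1⟩
  have h2 : (m.divisors.filter fun d => ¬ d * d ≤ m).card
      ≤ (m.divisors.filter fun d => d * d ≤ m).card := by
    refine Finset.card_le_card_of_injOn (fun d => m / d) ?_ ?_
    · intro d hd
      simp only [Finset.coe_filter, Nat.mem_divisors, Set.mem_ofPred_eq] at hd ⊢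
      obtain ⟨⟨⟨k, rfl⟩, hm⟩, hlt⟩ := hd
      have hd0 : 0 < d := Nat.pos_of_ne_zero (by rintro rfl; simp at hm)
      rw [Nat.mul_div_cancel_left k hd0]
      refine ⟨⟨dvd_mul_left k d, hm⟩, ?_⟩
      push Not at hlt
      have : k < d := Nat.lt_of_mul_lt_mul_left hlt
      exact Nat.mul_le_mul_right k this.le
    · intro d hd e he hde
      simp only [Finset.coe_filter, Nat.mem_divisors, Set.mem_ofPred_eq] at hd he
      simp only at hde
      have h := Nat.div_mul_cancel hd.1.1
      have h' := Nat.div_mul_cancel he.1.1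
      rw [← hde] at h'
      have hpos : 0 < m / d := Nat.div_pos (Nat.le_of_dvd (Nat.pos_of_ne_zero hd.1.2) hd.1.1)
        (Nat.pos_of_dvd_of_pos hd.1.1 (Nat.pos_of_ne_zero hd.1.2))
      exact Nat.eq_of_mul_eq_mul_left hpos (h.trans h'.symm)
  have h3 := Finset.card_filter_add_card_filter_not (s := m.divisors) (fun d => d * d ≤ m)
  omega

lemma sum_tau_le {b c : ℤ} {N : ℕ} (hpos : ∀ n : ℤ, 1 ≤ n → 0 < quad b c n)
    (hle : ∀ n : ℤ, 1 ≤ n → n ≤ N → quad b c n ≤ quad b c N) :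
    ((∑ n ∈ Finset.Icc 1 N, tau (quad b c (n : ℤ)) : ℕ) : ℝ)
      ≤ 2 * ∑ d ∈ Finset.Icc 1 (quad b c N).natAbs.sqrt,
        ((N : ℝ) / d + 1) * rootCount (disc b c) d := by
  set x := (quad b c N).natAbs.sqrt
  have h1 : ∑ n ∈ Finset.Icc 1 N, tau (quad b c (n : ℤ))
      ≤ 2 * ∑ d ∈ Finset.Icc 1 x,
        ((Finset.Icc 1 N).filter fun n : ℕ => (d : ℤ) ∣ quad b c n).card := by
    calc _ ≤ ∑ n ∈ Finset.Icc 1 N,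
          2 * ((Finset.Icc 1 x).filter (fun d : ℕ => (d : ℤ) ∣ quad b c n)).card := by
          refine Finset.sum_le_sum fun n hn => ?_
          rw [Finset.mem_Icc] at hn
          have a1 := hpos n (by exact_mod_cast hn.1)
          have a2 := hle n (by exact_mod_cast hn.1) (by exact_mod_cast hn.2)
          have := card_divisors_le (m := (quad b c n).natAbs) (F := (quad b c N).natAbs) (by omega)
          simp only [Int.natCast_dvd]
          exact this
      _ = _ := by
          rw [← Finset.mul_sum]
          simp only [Finset.card_filter]
          rw [Finset.sum_comm]
  refine (Nat.cast_le.2 h1).trans ?_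
  push_cast
  refine mul_le_mul_of_nonneg_left (Finset.sum_le_sum fun d hd => ?_) (by norm_num)
  exact card_dvd_quad_le b c N d (Finset.mem_Icc.1 hd).1

end QuadraticDivisorSum

theorem theorem2 (b c : ℤ)
    (hδ0 : QuadraticDivisorSum.disc b c ≠ 0)
    (hδsq : Squarefree (QuadraticDivisorSum.disc b c))
    (hδ4 : ¬ QuadraticDivisorSum.disc b c ≡ 1 [ZMOD 4])
    (hf : ∀ n : ℤ, 1 ≤ n → 0 ≤ QuadraticDivisorSum.quad b c n) :
    -- the series defining `L(1, χ)` converges, with (unique) sum `L`, and the bound holds with it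
    ∃ L : ℝ,
      Tendsto (fun K : ℕ => ∑ n ∈ Finset.Icc 1 K,
        (QuadraticDivisorSum.kroneckerSym (4 * QuadraticDivisorSum.disc b c) n : ℝ) / (n : ℝ))
        atTop (𝓝 L) ∧
      ∀ N : ℕ, 1 ≤ N →
        QuadraticDivisorSum.quad b c 1 ≤ QuadraticDivisorSum.quad b c (N : ℤ) →
        ∀ X M ζ₂ : ℝ,
          X = √(QuadraticDivisorSum.quad b c (N : ℤ) : ℝ) →
          M = QuadraticDivisorSum.polyaConst (QuadraticDivisorSum.disc b c) →
          ζ₂ = QuadraticDivisorSum.zetaTwo →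
          ((∑ n ∈ Finset.Icc 1 N,
              QuadraticDivisorSum.tau (QuadraticDivisorSum.quad b c (n : ℤ)) : ℕ) : ℝ) ≤
            2 / ζ₂ * L * (N : ℝ) * Real.log X
              + (2.332 * L + 4 * M / ζ₂) * (N : ℝ)
              + 2 * M / ζ₂ * X
              + 4 * √3 * (1 - 1 / ζ₂) * M * ((N : ℝ) / √X)
              + 2 * √3 * (1 - 1 / ζ₂) * M * √X := by
  open QuadraticDivisorSum in
  have hM : ∀ K, |∑ n ∈ Finset.Icc 1 K, (kroneckerSym (4 * disc b c) n : ℝ)|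
      ≤ polyaConst (disc b c) := by
    intro K
    exact_mod_cast abs_sum_kroneckerSym_le hδ0 hδsq hδ4 K
  obtain ⟨L, hL⟩ := exists_tendsto_sum_div hM
  refine ⟨L, hL, ?_⟩
  rintro N hN hN1 X M ζ₂ hX hMM rfl
  rw [← hMM] at hM
  have hL0 := limit_nonneg hδsq hδ4 hM hL
  have hM0 : 0 ≤ M := (abs_nonneg _).trans (hM 0)
  have hpos := fun n hn => quad_pos hδsq hδ4 hf (n := n) hn
  have hNpos := hpos N (by exact_mod_cast hN)
  have hsum := sum_tau_le (N := N) hpos (fun n h1 h2 => quad_le h1 h2 hN1)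
  -- x is the integer part of X; both squarefree bounds increase with the argument, so X may replace
  -- x in them.
  obtain ⟨x, hx⟩ : ∃ x, x = (quad b c N).natAbs.sqrt := ⟨_, rfl⟩
  rw [← hx] at hsum
  have hXnat : X = √((quad b c N).natAbs : ℝ) := by
    rw [hX]
    congr 1
    rw [Nat.cast_natAbs, abs_of_pos hNpos]
  have hx1 : 1 ≤ x := by
    rw [hx, Nat.le_sqrt]; omega
  have hx1r : (1 : ℝ) ≤ x := by exact_mod_cast hx1
  have hxX : (x : ℝ) ≤ X := by rw [hXnat, hx]; exact Real.nat_sqrt_le_real_sqrt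
  have hXx : X < x + 1 := by rw [hXnat, hx]; exact Real.real_sqrt_lt_nat_sqrt_succ
  have hX0 : 0 < X := by linarith
  have hN0 : (0 : ℝ) < N := by exact_mod_cast hN
  obtain ⟨hu1, hu2⟩ := inv_zetaTwo_bounds
  obtain ⟨u, hu⟩ : ∃ u, u = 1 / zetaTwo := ⟨_, rfl⟩
  have hQ : (sqfreeCount x : ℝ) ≤ u * X + √3 * (1 - u) * √X := by
    refine (sqfreeCount_le x).trans ?_
    rw [← hu] at hu1 hu2 ⊢
    have h1 : (x : ℝ) * u ≤ u * X := by
      rw [mul_comm]; exact mul_le_mul_of_nonneg_left hxX (by linarith)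
    have h2 : √3 * (1 - u) * √(x : ℝ) ≤ √3 * (1 - u) * √X :=
      mul_le_mul_of_nonneg_left (Real.sqrt_le_sqrt hxX)
        (mul_nonneg (Real.sqrt_nonneg _) (by linarith))
    linarith
  have hR : sqfreeRecip x ≤ u * Real.log X + 1.166 := by
    refine (sqfreeRecip_le hx1).trans ?_
    rw [← hu] at hu1 ⊢
    have := mul_le_mul_of_nonneg_left (Real.log_le_log (by linarith) hxX)
      (show 0 ≤ u by linarith)
    linarith
  have hS1 := sum_conv_div_le hM hL hX0 hXx
  have hS2 := sum_conv_le hM x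
  have hroot : ∑ d ∈ Finset.Icc 1 x, ((N : ℝ) / d + 1) * rootCount (disc b c) d
      ≤ N * ∑ d ∈ Finset.Icc 1 x, ((sqfreeArith * kroneckerArith (disc b c)) d : ℝ) / d
        + ∑ d ∈ Finset.Icc 1 x, ((sqfreeArith * kroneckerArith (disc b c)) d : ℝ) := by
    rw [Finset.mul_sum, ← Finset.sum_add_distrib]
    refine Finset.sum_le_sum fun d hd => ?_
    have := mul_le_mul_of_nonneg_left
      (rootCount_le_conv_real hδsq hδ4 (Finset.mem_Icc.1 hd).1)
      (show (0 : ℝ) ≤ (N : ℝ) / d + 1 by positivity)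
    refine this.trans (le_of_eq ?_)
    ring
  have hT1 : L * sqfreeRecip x + 2 * M / X * sqfreeCount x
      ≤ L * (u * Real.log X + 1.166) + 2 * M / X * (u * X + √3 * (1 - u) * √X) :=
    add_le_add (mul_le_mul_of_nonneg_left hR hL0)
      (mul_le_mul_of_nonneg_left hQ (by positivity))
  have hT2 := mul_le_mul_of_nonneg_left hQ hM0
  have hT3 := mul_le_mul_of_nonneg_left (hS1.trans hT1) hN0.le
  -- The coefficient 2.332 is 2 · 1.166, and √X / X = 1/√X produces the N/√X term.
  have hfin : 2 * (N * (L * (u * Real.log X + 1.166) + 2 * M / X * (u * X + √3 * (1 - u) * √X))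
        + M * (u * X + √3 * (1 - u) * √X))
      = 2 / zetaTwo * L * (N : ℝ) * Real.log X
              + (2.332 * L + 4 * M / zetaTwo) * (N : ℝ)
              + 2 * M / zetaTwo * X
              + 4 * √3 * (1 - 1 / zetaTwo) * M * ((N : ℝ) / √X)
              + 2 * √3 * (1 - 1 / zetaTwo) * M * √X := by
    have e1 : √X / X = 1 / √X := by
      rw [div_eq_div_iff hX0.ne' (Real.sqrt_pos.2 hX0).ne', one_mul, Real.mul_self_sqrt hX0.le]
    have e2 : 2 * M / X * (u * X + √3 * (1 - u) * √X)
        = 2 * M * u + 2 * M * √3 * (1 - u) * (1 / √X) := by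
      rw [← e1]; field_simp
    have e3 : 2 / zetaTwo = 2 * u := by rw [hu]; ring
    have e4 : ∀ y, y / zetaTwo = y * u := fun y => by rw [hu]; ring
    rw [e2, ← hu, e3, e4, e4]
    ring
  rw [← hfin]
  linarith
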